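/- A loop is a set with operations $\cdot,\backslash,/$ and a constant $1$ satisfying $x\cdot(x\backslash y)=y=x\backslash(x\cdot y)$, $(x/y)\cdot y=x=(x\cdot y)/y$ and $x\cdot 1=x=1\cdot x$. Let $\mathcal S(\mathsf{Loop})$ and $\mathcal S(\mathsf{Grp})$ be the categories of simplicial loops and of simplicial groups, and let $L=\pi_0\circ\mathcal S(I)\colon \mathcal S(\mathsf{Loop})\to\mathcal S(\mathsf{Grp})\to\mathsf{Grp}$, where $I$ is the reflector from loops to groups (applied degreewise) and $\pi_0$ is the connected components functor; $L$ is left adjoint to the inclusion $D$ that views a group as a discrete simplicial loop. Let $\eta$ be the unit of $L\dashv D$. A regular epimorphism $f\colon E\to B$ of simplicial loops is a *trivial extension* if the square with sides $\eta_E$, $f$, $DL(f)$, $\eta_B$ is a pullback, and a regular epimorphism $p\colon E\to B$ is a *normal extension* if the first projection $\pi_1\colon E\times_BE\to E$ of its kernel pair is a trivial extension. A normal extension $p\colon E\to B$ is *weakly universal* if for every normal extension $p'\colon E'\to B$ there is $u\colon E\to E'$ with $p'u=p$. The fundamental group $\pi_1(B)$ is the Galois group $$\mathrm{Gal}(E,p,0)=\ker\bigl(\langle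 L(\pi_1),L(\pi_2)\rangle\colon L(E\times_BE)\to L(E)\times L(E)\bigr)$$ of a weakly universal normal extension $p\colon E\to B$. For a simplicial loop $A$, let $A_0$ be the connected component of $1$ in $A$, that is, the simplicial subloop of the simplices whose vertices lie in the connected component of the vertex $1$. For a normal subobject $K$ of $A$ (a kernel of some morphism from $A$), let $[K,A,A]$ be the associator, defined degreewise: in degree $n$ it is the normal subloop of $A_n$ generated by the elements $((xy)z)/(x(yz))$ with $x,y,z\in A_n$ at least one of which is in $K_n$. Let $f\colon P\to B$ be a projective presentation of a simplicial loop $B$, that is, a regular epimorphism whose domain $P$ is projective with respect to regular epimorphisms, and let $K$ be the kernel of $f$. Then $B$ has a weakly universal normal extension, $[K,P,P]\vee K_0\le K\wedge([P,P,P]\vee P_0)$, and for every weakly universal normal extension $p\colon E\to B$ there is an isomorphism (of simplicial loops, the group on the left being viewed as a discrete one) $$\pi_1(B)=\mathrm{Gal}(E,p,0)\;\cong\;\frac{K\wedge([P,P,P]\vee P_0)}{[K,P,P]\vee K_0},$$ where $\vee$ and $\wedge$ are the supremum and infimum of normal subobjects (in $P$ for the numerator, in $K$ for $[K,P,P]\vee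 K_0$). -/

import Mathlib

open CategoryTheory CategoryTheory.Limits Opposite
open scoped Simplicial

universe u

/-! ### Loops -/

/-- A loop: a multiplication with unit `1`, left division `ldiv x y = x \ y` and right division
`rdiv x y = x / y`. -/
class AlgLoop (L : Type u) extends MulOneClass L where
  /-- left division, `x \ y` -/
  ldiv : L → L → L
  /-- right division, `x / y` -/
  rdiv : L → L → L
  mul_ldiv : ∀ x y : L, x * ldiv x y = y
  ldiv_mul : ∀ x y : L, ldiv x (x * y) = y
  rdiv_mul : ∀ x y : L, rdiv x y * y = x
  mul_rdiv : ∀ x y : L, rdiv (x * y) y = x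

namespace AlgLoop

attribute [simp] mul_ldiv ldiv_mul rdiv_mul mul_rdiv

section
variable {L M : Type u} [AlgLoop L] [AlgLoop M]

theorem mul_left_cancel' {x y z : L} (h : x * y = x * z) : y = z := by
  rw [← ldiv_mul x y, h, ldiv_mul]

theorem mul_right_cancel' {x y z : L} (h : x * z = y * z) : x = y := by
  rw [← mul_rdiv x z, h, mul_rdiv]

@[simp] theorem ldiv_self (x : L) : ldiv x x = 1 := by
  simpa using ldiv_mul x (1 : L)

@[simp] theorem rdiv_self (x : L) : rdiv x x = 1 := by
  simpa using mul_rdiv (1 : L) x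

/-- A map of loops that preserves the multiplication and the unit preserves both divisions, so that
homomorphisms of loops are the same as the `MonoidHom`s between them. -/
theorem map_ldiv (f : L →* M) (x y : L) : f (ldiv x y) = ldiv (f x) (f y) := by
  apply mul_left_cancel' (x := f x)
  rw [← map_mul, mul_ldiv, mul_ldiv]

theorem map_rdiv (f : L →* M) (x y : L) : f (rdiv x y) = rdiv (f x) (f y) := by
  apply mul_right_cancel' (z := f y)
  rw [← map_mul, rdiv_mul, rdiv_mul]

end

/-- A group is a loop. -/
@[reducible] def ofGroup (G : Type u) [Group G] : AlgLoop G where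
  ldiv x y := x⁻¹ * y
  rdiv x y := x * y⁻¹
  mul_ldiv x y := by simp
  ldiv_mul x y := by simp
  rdiv_mul x y := by simp
  mul_rdiv x y := by simp

end AlgLoop

open AlgLoop

/-- A normal subloop: a subset that contains `1`, is closed under the three operations and is stable
under the inner mappings `T`, `L`, `R` of the loop and under their inverses; equivalently
`xN = Nx`, `x(yN) = (xy)N` and `(Nx)y = N(xy)` for all `x`, `y`. -/
@[ext]
structure NormalSubloop (L : Type u) [AlgLoop L] where
  /-- the underlying set -/
  carrier : Set L
  one_mem : (1 : L) ∈ carrier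
  mul_mem : ∀ {a b}, a ∈ carrier → b ∈ carrier → a * b ∈ carrier
  ldiv_mem : ∀ {a b}, a ∈ carrier → b ∈ carrier → ldiv a b ∈ carrier
  rdiv_mem : ∀ {a b}, a ∈ carrier → b ∈ carrier → rdiv a b ∈ carrier
  innerT_mem : ∀ (x : L) {a}, a ∈ carrier → ldiv x (a * x) ∈ carrier
  innerT_inv_mem : ∀ (x : L) {a}, a ∈ carrier → rdiv (x * a) x ∈ carrier
  innerL_mem : ∀ (x y : L) {a}, a ∈ carrier → ldiv (x * y) (x * (y * a)) ∈ carrier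
  innerL_inv_mem : ∀ (x y : L) {a}, a ∈ carrier → ldiv y (ldiv x ((x * y) * a)) ∈ carrier
  innerR_mem : ∀ (x y : L) {a}, a ∈ carrier → rdiv ((a * x) * y) (x * y) ∈ carrier
  innerR_inv_mem : ∀ (x y : L) {a}, a ∈ carrier → rdiv (rdiv (a * (x * y)) y) x ∈ carrier

namespace NormalSubloop

section
variable {L M : Type u} [AlgLoop L] [AlgLoop M]

instance : Membership L (NormalSubloop L) := ⟨fun N x => x ∈ N.carrier⟩

/-- The class of `1` of a congruence of loops. -/
def ofCongruence (r : L → L → Prop) (hr : Equivalence r)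
    (hmul : ∀ {a b c d}, r a b → r c d → r (a * c) (b * d))
    (hldiv : ∀ {a b c d}, r a b → r c d → r (ldiv a c) (ldiv b d))
    (hrdiv : ∀ {a b c d}, r a b → r c d → r (rdiv a c) (rdiv b d)) : NormalSubloop L where
  carrier := {x | r x 1}
  one_mem := hr.refl 1
  mul_mem ha hb := by simpa using hmul ha hb
  ldiv_mem ha hb := by simpa using hldiv ha hb
  rdiv_mem ha hb := by simpa using hrdiv ha hb
  innerT_mem x a ha := by simpa using hldiv (hr.refl x) (hmul ha (hr.refl x))
  innerT_inv_mem x a ha := by simpa using hrdiv (hmul (hr.refl x) ha) (hr.refl x)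
  innerL_mem x y a ha := by
    simpa using hldiv (hr.refl (x * y)) (hmul (hr.refl x) (hmul (hr.refl y) ha))
  innerL_inv_mem x y a ha := by
    simpa using hldiv (hr.refl y) (hldiv (hr.refl x) (hmul (hr.refl (x * y)) ha))
  innerR_mem x y a ha := by
    simpa using hrdiv (hmul (hmul ha (hr.refl x)) (hr.refl y)) (hr.refl (x * y))
  innerR_inv_mem x y a ha := by
    simpa using hrdiv (hrdiv (hmul ha (hr.refl (x * y))) (hr.refl y)) (hr.refl x)

/-- The inverse image of a normal subloop under a homomorphism. -/
def comap (f : L →* M) (N : NormalSubloop M) : NormalSubloop L where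
  carrier := {x | f x ∈ N.carrier}
  one_mem := by simpa using N.one_mem
  mul_mem ha hb := by simpa using N.mul_mem ha hb
  ldiv_mem ha hb := by simpa [map_ldiv] using N.ldiv_mem ha hb
  rdiv_mem ha hb := by simpa [map_rdiv] using N.rdiv_mem ha hb
  innerT_mem x a ha := by simpa [map_ldiv] using N.innerT_mem (f x) ha
  innerT_inv_mem x a ha := by simpa [map_rdiv] using N.innerT_inv_mem (f x) ha
  innerL_mem x y a ha := by simpa [map_ldiv] using N.innerL_mem (f x) (f y) ha
  innerL_inv_mem x y a ha := by simpa [map_ldiv] using N.innerL_inv_mem (f x) (f y) ha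
  innerR_mem x y a ha := by simpa [map_rdiv] using N.innerR_mem (f x) (f y) ha
  innerR_inv_mem x y a ha := by simpa [map_rdiv] using N.innerR_inv_mem (f x) (f y) ha

/-- The kernel of a homomorphism of loops. -/
def ker (f : L →* M) : NormalSubloop L :=
  ofCongruence (fun x y => f x = f y) ⟨fun _ => rfl, fun h => h.symm, fun h h' => h.trans h'⟩
    (fun h h' => by simp [h, h']) (fun h h' => by simp [map_ldiv, h, h'])
    (fun h h' => by simp [map_rdiv, h, h'])

/-- The intersection of a family of normal subloops. -/
def sInf (S : Set (NormalSubloop L)) : NormalSubloop L where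
  carrier := {x | ∀ N ∈ S, x ∈ N}
  one_mem N _ := N.one_mem
  mul_mem ha hb N h := N.mul_mem (ha N h) (hb N h)
  ldiv_mem ha hb N h := N.ldiv_mem (ha N h) (hb N h)
  rdiv_mem ha hb N h := N.rdiv_mem (ha N h) (hb N h)
  innerT_mem x _ ha N h := N.innerT_mem x (ha N h)
  innerT_inv_mem x _ ha N h := N.innerT_inv_mem x (ha N h)
  innerL_mem x y _ ha N h := N.innerL_mem x y (ha N h)
  innerL_inv_mem x y _ ha N h := N.innerL_inv_mem x y (ha N h)
  innerR_mem x y _ ha N h := N.innerR_mem x y (ha N h)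
  innerR_inv_mem x y _ ha N h := N.innerR_inv_mem x y (ha N h)

/-- The normal subloop generated by a set. -/
def normalClosure (S : Set L) : NormalSubloop L := sInf {N | S ⊆ N.carrier}

theorem subset_normalClosure (S : Set L) : S ⊆ (normalClosure S).carrier :=
  fun _ hx _ hN => hN hx

theorem normalClosure_le {S : Set L} {N : NormalSubloop L} (h : S ⊆ N.carrier) {x : L}
    (hx : x ∈ normalClosure S) : x ∈ N := hx N h

/-- The whole loop as a normal subloop of itself. -/
def top (L : Type u) [AlgLoop L] : NormalSubloop L :=
  ofCongruence (fun _ _ => True) ⟨fun _ => trivial, fun _ => trivial, fun _ _ => trivial⟩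
    (fun _ _ => trivial) (fun _ _ => trivial) (fun _ _ => trivial)

theorem mem_top (x : L) : x ∈ top L := trivial

/-- The associator element `((xy)z) / (x(yz))`. -/
def assocElt (x y z : L) : L := rdiv ((x * y) * z) (x * (y * z))

theorem map_assocElt (f : L →* M) (x y z : L) :
    f (assocElt x y z) = assocElt (f x) (f y) (f z) := by
  simp [assocElt, map_rdiv]

/-- The set of associator elements with at least one entry in `K`. -/
def assocSet (K : NormalSubloop L) : Set L :=
  {a | ∃ k x y : L, k ∈ K ∧ (a = assocElt k x y ∨ a = assocElt x k y ∨ a = assocElt x y k)}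

/-- The associator `[K, L, L]` of a normal subloop `K` of `L`: the normal subloop of `L` generated
by the associator elements with at least one entry in `K`. -/
def associator (K : NormalSubloop L) : NormalSubloop L := normalClosure (assocSet K)

theorem map_mem_associator (f : L →* M) {K : NormalSubloop L} {K' : NormalSubloop M}
    (h : ∀ x ∈ K, f x ∈ K') {x : L} (hx : x ∈ associator K) : f x ∈ associator K' := by
  refine normalClosure_le (N := (associator K').comap f) ?_ hx
  rintro a ⟨k, x, y, hk, h1⟩
  apply subset_normalClosure
  refine ⟨f k, f x, f y, h k hk, ?_⟩
  rcases h1 with h1 | h1 | h1 <;> subst h1 <;> simp [map_assocElt]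

/-- A normal subloop is a loop. -/
instance (N : NormalSubloop L) : AlgLoop {x // x ∈ N} where
  mul a b := ⟨a.1 * b.1, N.mul_mem a.2 b.2⟩
  one := ⟨1, N.one_mem⟩
  one_mul a := Subtype.ext (one_mul a.1)
  mul_one a := Subtype.ext (mul_one a.1)
  ldiv a b := ⟨ldiv a.1 b.1, N.ldiv_mem a.2 b.2⟩
  rdiv a b := ⟨rdiv a.1 b.1, N.rdiv_mem a.2 b.2⟩
  mul_ldiv a b := Subtype.ext (mul_ldiv a.1 b.1)
  ldiv_mul a b := Subtype.ext (ldiv_mul a.1 b.1)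
  rdiv_mul a b := Subtype.ext (rdiv_mul a.1 b.1)
  mul_rdiv a b := Subtype.ext (mul_rdiv a.1 b.1)

/-- The inclusion of a normal subloop. -/
def subtype (N : NormalSubloop L) : {x // x ∈ N} →* L where
  toFun := Subtype.val
  map_one' := rfl
  map_mul' _ _ := rfl

/-! The quotient of a loop by a normal subloop. -/

/-- `x` and `y` are congruent modulo `N` when `y ∈ xN`. -/
def rel (N : NormalSubloop L) (x y : L) : Prop := ∃ n ∈ N, y = x * n

theorem comm_right (N : NormalSubloop L) (x : L) {n : L} (hn : n ∈ N) :
    ∃ m ∈ N, x * n = m * x := ⟨_, N.innerT_inv_mem x hn, by simp⟩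

theorem comm_left (N : NormalSubloop L) (x : L) {n : L} (hn : n ∈ N) :
    ∃ m ∈ N, n * x = x * m := ⟨_, N.innerT_mem x hn, by simp⟩

theorem assoc_right (N : NormalSubloop L) (x y : L) {n : L} (hn : n ∈ N) :
    ∃ m ∈ N, x * (y * n) = (x * y) * m := ⟨_, N.innerL_mem x y hn, by simp⟩

theorem assoc_right' (N : NormalSubloop L) (x y : L) {n : L} (hn : n ∈ N) :
    ∃ m ∈ N, (x * y) * n = x * (y * m) := ⟨_, N.innerL_inv_mem x y hn, by simp⟩

theorem assoc_left (N : NormalSubloop L) (x y : L) {n : L} (hn : n ∈ N) :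
    ∃ m ∈ N, (n * x) * y = m * (x * y) := ⟨_, N.innerR_mem x y hn, by simp⟩

theorem assoc_left' (N : NormalSubloop L) (x y : L) {n : L} (hn : n ∈ N) :
    ∃ m ∈ N, n * (x * y) = (m * x) * y := ⟨_, N.innerR_inv_mem x y hn, by simp⟩

theorem rel_equivalence (N : NormalSubloop L) : Equivalence N.rel where
  refl x := ⟨1, N.one_mem, by simp⟩
  symm := by
    rintro x y ⟨n, hn, rfl⟩
    obtain ⟨m, hm, e⟩ := N.assoc_right x n (N.ldiv_mem hn N.one_mem)
    exact ⟨m, hm, by simpa using e⟩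
  trans := by
    rintro x y z ⟨n, hn, rfl⟩ ⟨m, hm, rfl⟩
    obtain ⟨k, hk, e⟩ := N.assoc_right' x n hm
    exact ⟨n * k, N.mul_mem hn hk, e⟩

theorem rel_mul (N : NormalSubloop L) {a b c d : L} (h : N.rel a b) (h' : N.rel c d) :
    N.rel (a * c) (b * d) := by
  obtain ⟨n, hn, rfl⟩ := h
  obtain ⟨m, hm, rfl⟩ := h'
  obtain ⟨n1, hn1, e1⟩ := N.comm_right a hn
  obtain ⟨n2, hn2, e2⟩ := N.assoc_left a (c * m) hn1
  obtain ⟨m1, hm1, e3⟩ := N.assoc_right a c hm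
  obtain ⟨n3, hn3, e4⟩ := N.assoc_left' (a * c) m1 hn2
  obtain ⟨n4, hn4, e5⟩ := N.comm_left (a * c) hn3
  obtain ⟨m2, hm2, e6⟩ := N.assoc_right' (a * c) n4 hm1
  exact ⟨n4 * m2, N.mul_mem hn4 hm2, by rw [e1, e2, e3, e4, e5, e6]⟩

theorem rel_ldiv (N : NormalSubloop L) {a b c d : L} (h : N.rel a b) (h' : N.rel c d) :
    N.rel (ldiv a c) (ldiv b d) := by
  have h1 : N.rel (b * ldiv a c) (b * ldiv b d) := by
    have := N.rel_mul (N.rel_equivalence.symm h) (N.rel_equivalence.refl (ldiv a c))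
    rw [mul_ldiv] at this ⊢
    exact N.rel_equivalence.trans this h'
  obtain ⟨n, hn, e⟩ := h1
  obtain ⟨m, hm, e'⟩ := N.assoc_right' b (ldiv a c) hn
  exact ⟨m, hm, mul_left_cancel' (e.trans e')⟩

theorem rel_rdiv (N : NormalSubloop L) {a b c d : L} (h : N.rel a b) (h' : N.rel c d) :
    N.rel (rdiv a c) (rdiv b d) := by
  have h1 : N.rel (rdiv a c * d) (rdiv b d * d) := by
    have := N.rel_mul (N.rel_equivalence.refl (rdiv a c)) h'
    rw [rdiv_mul] at this ⊢
    exact N.rel_equivalence.trans (N.rel_equivalence.symm this) h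
  obtain ⟨n, hn, e⟩ := h1
  obtain ⟨n1, hn1, e1⟩ := N.comm_right (rdiv a c * d) hn
  obtain ⟨n2, hn2, e2⟩ := N.assoc_left' (rdiv a c) d hn1
  obtain ⟨n3, hn3, e3⟩ := N.comm_left (rdiv a c) hn2
  exact ⟨n3, hn3, (mul_right_cancel' (e.trans (e1.trans e2))).trans e3⟩

/-- Congruence modulo a normal subloop. -/
def setoid (N : NormalSubloop L) : Setoid L := ⟨N.rel, N.rel_equivalence⟩

/-- The quotient `L/N` of a loop by a normal subloop. -/
def Quot (N : NormalSubloop L) : Type u := Quotient N.setoid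

instance (N : NormalSubloop L) : AlgLoop N.Quot where
  mul := Quotient.map₂ (fun x y => x * y) (fun _ _ h _ _ h' => N.rel_mul h h')
  one := Quotient.mk _ 1
  one_mul := by rintro ⟨a⟩; exact congrArg (Quotient.mk N.setoid) (one_mul a)
  mul_one := by rintro ⟨a⟩; exact congrArg (Quotient.mk N.setoid) (mul_one a)
  ldiv := Quotient.map₂ ldiv (fun _ _ h _ _ h' => N.rel_ldiv h h')
  rdiv := Quotient.map₂ rdiv (fun _ _ h _ _ h' => N.rel_rdiv h h')
  mul_ldiv := by rintro ⟨a⟩ ⟨b⟩; exact congrArg (Quotient.mk N.setoid) (mul_ldiv a b)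
  ldiv_mul := by rintro ⟨a⟩ ⟨b⟩; exact congrArg (Quotient.mk N.setoid) (ldiv_mul a b)
  rdiv_mul := by rintro ⟨a⟩ ⟨b⟩; exact congrArg (Quotient.mk N.setoid) (rdiv_mul a b)
  mul_rdiv := by rintro ⟨a⟩ ⟨b⟩; exact congrArg (Quotient.mk N.setoid) (mul_rdiv a b)

/-- The quotient homomorphism `L → L/N`. -/
def toQuot (N : NormalSubloop L) : L →* N.Quot where
  toFun := Quotient.mk N.setoid
  map_one' := rfl
  map_mul' _ _ := rfl

theorem toQuot_surjective (N : NormalSubloop L) : Function.Surjective N.toQuot := Quotient.mk_surjective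

theorem toQuot_eq_toQuot (N : NormalSubloop L) {x y : L} : N.toQuot x = N.toQuot y ↔ ∃ n ∈ N, y = x * n :=
  Quotient.eq (r := N.setoid)

/-- A homomorphism that is trivial on `N` factors through `L/N`. -/
def lift (N : NormalSubloop L) (f : L →* M) (h : ∀ n ∈ N, f n = 1) : N.Quot →* M where
  toFun := Quotient.lift f (by rintro a b ⟨n, hn, rfl⟩; simp [h n hn])
  map_one' := map_one f
  map_mul' := by rintro ⟨a⟩ ⟨b⟩; exact map_mul f a b

@[simp] theorem lift_toQuot (N : NormalSubloop L) (f : L →* M) (h : ∀ n ∈ N, f n = 1) (x : L) :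
    N.lift f h (N.toQuot x) = f x := rfl

theorem toQuot_eq_one (N : NormalSubloop L) {n : L} (hn : n ∈ N) : N.toQuot n = 1 := by
  have : N.toQuot 1 = N.toQuot n := N.toQuot_eq_toQuot.2 ⟨n, hn, by simp⟩
  rw [← this, map_one]

/-- The homomorphism `L/N → M/N'` induced by a homomorphism `L → M` that maps `N` into `N'`. -/
def mapQuot (N : NormalSubloop L) (N' : NormalSubloop M) (f : L →* M)
    (h : ∀ n ∈ N, f n ∈ N') : N.Quot →* N'.Quot :=
  N.lift (N'.toQuot.comp f) (fun n hn => N'.toQuot_eq_one (h n hn))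

@[simp] theorem mapQuot_toQuot (N : NormalSubloop L) (N' : NormalSubloop M) (f : L →* M)
    (h : ∀ n ∈ N, f n ∈ N') (x : L) : N.mapQuot N' f h (N.toQuot x) = N'.toQuot (f x) := rfl

end

end NormalSubloop

/-! ### The category of loops -/

/-- The category of loops. -/
structure LoopCat : Type (u + 1) where
  /-- the underlying type -/
  carrier : Type u
  [str : AlgLoop carrier]

attribute [instance] LoopCat.str

namespace LoopCat

instance : CoeSort LoopCat (Type u) := ⟨LoopCat.carrier⟩

/-- Homomorphisms of loops. -/
@[ext]
structure Hom (A B : LoopCat.{u}) where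
  /-- the underlying homomorphism -/
  hom' : A →* B

instance : Category LoopCat.{u} where
  Hom A B := Hom A B
  id A := ⟨MonoidHom.id A⟩
  comp f g := ⟨g.hom'.comp f.hom'⟩

instance : ConcreteCategory LoopCat.{u} (· →* ·) where
  hom := Hom.hom'
  ofHom := Hom.mk

/-- The homomorphism underlying a morphism in `LoopCat`. -/
abbrev Hom.hom {A B : LoopCat.{u}} (f : A ⟶ B) : A →* B := ConcreteCategory.hom f

/-- The bundled loop on a type. -/
abbrev of (L : Type u) [AlgLoop L] : LoopCat := ⟨L⟩

/-- A homomorphism of loops as a morphism in `LoopCat`. -/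
abbrev ofHom {L M : Type u} [AlgLoop L] [AlgLoop M] (f : L →* M) : of L ⟶ of M :=
  ConcreteCategory.ofHom (C := LoopCat) f

/-- The loop underlying the pullback of two homomorphisms. -/
instance pullbackLoop {A B C : LoopCat.{u}} (f : A ⟶ C) (g : B ⟶ C) :
    AlgLoop {x : A × B // f x.1 = g x.2} where
  mul a b := ⟨(a.1.1 * b.1.1, a.1.2 * b.1.2), by simp [a.2, b.2]⟩
  one := ⟨(1, 1), by simp⟩
  one_mul a := Subtype.ext (Prod.ext (one_mul _) (one_mul _))
  mul_one a := Subtype.ext (Prod.ext (mul_one _) (mul_one _))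
  ldiv a b := ⟨(ldiv a.1.1 b.1.1, ldiv a.1.2 b.1.2), by
    have := map_ldiv f.hom a.1.1 b.1.1
    have h2 := map_ldiv g.hom a.1.2 b.1.2
    exact this.trans (by rw [h2, a.2, b.2])⟩
  rdiv a b := ⟨(rdiv a.1.1 b.1.1, rdiv a.1.2 b.1.2), by
    have := map_rdiv f.hom a.1.1 b.1.1
    have h2 := map_rdiv g.hom a.1.2 b.1.2
    exact this.trans (by rw [h2, a.2, b.2])⟩
  mul_ldiv a b := Subtype.ext (Prod.ext (mul_ldiv _ _) (mul_ldiv _ _))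
  ldiv_mul a b := Subtype.ext (Prod.ext (ldiv_mul _ _) (ldiv_mul _ _))
  rdiv_mul a b := Subtype.ext (Prod.ext (rdiv_mul _ _) (rdiv_mul _ _))
  mul_rdiv a b := Subtype.ext (Prod.ext (mul_rdiv _ _) (mul_rdiv _ _))

/-- The explicit pullback cone. -/
def pullbackCone {A B C : LoopCat.{u}} (f : A ⟶ C) (g : B ⟶ C) : PullbackCone f g :=
  PullbackCone.mk (W := of {x : A × B // f x.1 = g x.2})
    (ConcreteCategory.ofHom (C := LoopCat) (X := of {x : A × B // f x.1 = g x.2}) (Y := A)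
      { toFun := fun x => x.1.1, map_one' := rfl, map_mul' := fun _ _ => rfl })
    (ConcreteCategory.ofHom (C := LoopCat) (X := of {x : A × B // f x.1 = g x.2}) (Y := B)
      { toFun := fun x => x.1.2, map_one' := rfl, map_mul' := fun _ _ => rfl })
    (by ext x; exact x.2)

/-- The explicit pullback cone is a limit. -/
def pullbackConeIsLimit {A B C : LoopCat.{u}} (f : A ⟶ C) (g : B ⟶ C) :
    IsLimit (pullbackCone f g) :=
  PullbackCone.IsLimit.mk _
    (fun s => ConcreteCategory.ofHom (C := LoopCat) (X := s.pt)
      (Y := of {x : A × B // f x.1 = g x.2})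
      { toFun := fun x => ⟨(s.fst x, s.snd x), ConcreteCategory.congr_hom s.condition x⟩
        map_one' := Subtype.ext (Prod.ext (map_one s.fst.hom) (map_one s.snd.hom))
        map_mul' := fun x y =>
          Subtype.ext (Prod.ext (map_mul s.fst.hom x y) (map_mul s.snd.hom x y)) })
    (fun s => by ext x; rfl)
    (fun s => by ext x; rfl)
    (fun s m h1 h2 => by
      refine ConcreteCategory.hom_ext _ _ fun x => ?_
      exact Subtype.ext (Prod.ext (ConcreteCategory.congr_hom h1 x)
        (ConcreteCategory.congr_hom h2 x)))

instance : HasPullbacks LoopCat.{u} :=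
  have := fun {X Y Z : LoopCat.{u}} {f : X ⟶ Z} {g : Y ⟶ Z} =>
    (⟨⟨_, pullbackConeIsLimit f g⟩⟩ : HasLimit (cospan f g))
  hasPullbacks_of_hasLimit_cospan _

end LoopCat

/-! ### The reflection of loops into groups -/

/-- The inclusion `H` of groups into loops. -/
def grpToLoop : GrpCat.{u} ⥤ LoopCat.{u} where
  obj G := @LoopCat.of G (AlgLoop.ofGroup G)
  map {G G'} f := @LoopCat.ofHom G G' (AlgLoop.ofGroup G) (AlgLoop.ofGroup G') f.hom

/-- The loop `L/[L,L,L]` is a group. -/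
instance groupReflection (L : Type u) [AlgLoop L] :
    Group (NormalSubloop.associator (NormalSubloop.top L)).Quot where
  mul_assoc := by
    intro a b c
    obtain ⟨a, rfl⟩ := NormalSubloop.toQuot_surjective _ a
    obtain ⟨b, rfl⟩ := NormalSubloop.toQuot_surjective _ b
    obtain ⟨c, rfl⟩ := NormalSubloop.toQuot_surjective _ c
    have h : NormalSubloop.assocElt a b c ∈
        NormalSubloop.associator (NormalSubloop.top L) :=
      NormalSubloop.subset_normalClosure _
        ⟨a, b, c, NormalSubloop.mem_top a, Or.inl rfl⟩
    have h' := NormalSubloop.toQuot_eq_one _ h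
    rw [NormalSubloop.map_assocElt, NormalSubloop.assocElt] at h'
    rw [← rdiv_mul (_ * _ * _) (NormalSubloop.toQuot _ a * (NormalSubloop.toQuot _ b *
      NormalSubloop.toQuot _ c)), h', one_mul]
  one_mul := one_mul
  mul_one := mul_one
  inv a := rdiv 1 a
  inv_mul_cancel a := rdiv_mul 1 a

/-- The group reflection `I`, `I(L) = L/[L,L,L]`. -/
def loopToGrp : LoopCat.{u} ⥤ GrpCat.{u} where
  obj L := GrpCat.of (NormalSubloop.associator (NormalSubloop.top L)).Quot
  map {L M} f := GrpCat.ofHom (NormalSubloop.mapQuot _ _ f.hom (fun _ h =>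
    NormalSubloop.map_mem_associator f.hom (fun _ _ => NormalSubloop.mem_top _) h))
  map_id L := by
    ext x
    obtain ⟨x, rfl⟩ := NormalSubloop.toQuot_surjective _ x
    rfl
  map_comp f g := by
    ext x
    obtain ⟨x, rfl⟩ := NormalSubloop.toQuot_surjective _ x
    rfl

theorem map_associator_eq_one {L G : Type u} [AlgLoop L] [Group G] (f : L →* G) {x : L}
    (hx : x ∈ NormalSubloop.associator (NormalSubloop.top L)) : f x = 1 := by
  let _ := AlgLoop.ofGroup G
  have : x ∈ NormalSubloop.ker f := by
    refine NormalSubloop.normalClosure_le ?_ hx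
    rintro a ⟨k, y, z, -, h⟩
    have key : ∀ u v w : L, f (NormalSubloop.assocElt u v w) = f 1 := by
      intro u v w
      rw [NormalSubloop.map_assocElt, NormalSubloop.assocElt, mul_assoc, rdiv_self, map_one]
    rcases h with h | h | h <;> subst h <;> exact key _ _ _
  exact (show f x = f 1 from this).trans (map_one f)

/-- `I` is left adjoint to `H`. -/
def loopGrpAdj : loopToGrp.{u} ⊣ grpToLoop.{u} :=
  Adjunction.mkOfHomEquiv
    { homEquiv := fun L G =>
        { toFun := fun f => ConcreteCategory.ofHom (C := LoopCat) (X := L) (Y := grpToLoop.obj G)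
            (f.hom.comp (NormalSubloop.toQuot _))
          invFun := fun f => GrpCat.ofHom
            (letI := AlgLoop.ofGroup G
             NormalSubloop.lift _ (M := G) f.hom
              (fun _ h => map_associator_eq_one (G := G) f.hom h))
          left_inv := fun f => by
            ext x
            obtain ⟨x, rfl⟩ := NormalSubloop.toQuot_surjective _ x
            rfl
          right_inv := fun f => by ext x; rfl }
      homEquiv_naturality_left_symm := fun f g => by
        ext x
        obtain ⟨x, rfl⟩ := NormalSubloop.toQuot_surjective _ x
        rfl
      homEquiv_naturality_right := fun f g => by ext x; rfl }

/-! ### Connected components of simplicial groups -/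

/-- The normal subgroup of `G₀` generated by the elements `d₀(e) d₁(e)⁻¹`, `e ∈ G₁`. -/
def pi0Kernel (G : SimplicialObject GrpCat.{u}) : Subgroup (G _⦋0⦌) :=
  Subgroup.normalClosure {x | ∃ e : G _⦋1⦌, x = G.δ 0 e * (G.δ 1 e)⁻¹}

instance (G : SimplicialObject GrpCat.{u}) : (pi0Kernel G).Normal :=
  Subgroup.normalClosure_normal

theorem pi0Kernel_le_comap {G G' : SimplicialObject GrpCat.{u}} (f : G ⟶ G') :
    pi0Kernel G ≤ (pi0Kernel G').comap (f.app (op ⦋0⦌)).hom := by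
  refine Subgroup.normalClosure_le_normal ?_
  rintro x ⟨e, rfl⟩
  refine Subgroup.subset_normalClosure ⟨f.app (op ⦋1⦌) e, ?_⟩
  have h0 := ConcreteCategory.congr_hom (SimplicialObject.δ_naturality f (0 : Fin 2)) e
  have h1 := ConcreteCategory.congr_hom (SimplicialObject.δ_naturality f (1 : Fin 2)) e
  simp only [ConcreteCategory.comp_apply] at h0 h1
  rw [← h0, ← h1]
  simp

/-- The connected components functor `π₀` on simplicial groups: the coequaliser of
`d₀, d₁ : G₁ → G₀`. -/
def pi0Grp : SimplicialObject GrpCat.{u} ⥤ GrpCat.{u} where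
  obj G := GrpCat.of (G _⦋0⦌ ⧸ pi0Kernel G)
  map f := GrpCat.ofHom (QuotientGroup.map _ _ (f.app (op ⦋0⦌)).hom (pi0Kernel_le_comap f))
  map_id G := by
    refine ConcreteCategory.hom_ext _ _ fun x => ?_
    obtain ⟨x, rfl⟩ := QuotientGroup.mk_surjective x
    rfl
  map_comp f g := by
    refine ConcreteCategory.hom_ext _ _ fun x => ?_
    obtain ⟨x, rfl⟩ := QuotientGroup.mk_surjective x
    rfl

/-- The discrete simplicial group functor `D`. -/
abbrev discreteGrp : GrpCat.{u} ⥤ SimplicialObject GrpCat.{u} :=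
  Functor.const SimplexCategoryᵒᵖ

theorem pi0_vertex_eq (G : SimplicialObject GrpCat.{u}) {n : ℕ} (x : G _⦋n⦌)
    (i j : Fin (n + 1)) (h : i ≤ j) :
    (QuotientGroup.mk (G.map (SimplexCategory.const ⦋0⦌ ⦋n⦌ i).op x) : G _⦋0⦌ ⧸ pi0Kernel G) =
      QuotientGroup.mk (G.map (SimplexCategory.const ⦋0⦌ ⦋n⦌ j).op x) := by
  have e0 : SimplexCategory.δ (0 : Fin 2) ≫ SimplexCategory.mkOfLe i j h =
      SimplexCategory.const ⦋0⦌ ⦋n⦌ j := by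
    ext k; fin_cases k; rfl
  have e1 : SimplexCategory.δ (1 : Fin 2) ≫ SimplexCategory.mkOfLe i j h =
      SimplexCategory.const ⦋0⦌ ⦋n⦌ i := by
    ext k; fin_cases k; rfl
  have h0 : G.δ 0 (G.map (SimplexCategory.mkOfLe i j h).op x) =
      G.map (SimplexCategory.const ⦋0⦌ ⦋n⦌ j).op x := by
    rw [← e0, op_comp, G.map_comp]; rfl
  have h1 : G.δ 1 (G.map (SimplexCategory.mkOfLe i j h).op x) =
      G.map (SimplexCategory.const ⦋0⦌ ⦋n⦌ i).op x := by
    rw [← e1, op_comp, G.map_comp]; rfl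
  symm
  rw [← h0, ← h1, QuotientGroup.eq_iff_div_mem, div_eq_mul_inv]
  exact Subgroup.subset_normalClosure ⟨_, rfl⟩

/-- The unit `G → D(π₀(G))`: a simplex is sent to the component of its initial vertex. -/
def pi0Unit (G : SimplicialObject GrpCat.{u}) : G ⟶ discreteGrp.obj (pi0Grp.obj G) where
  app n := GrpCat.ofHom ((QuotientGroup.mk' (pi0Kernel G)).comp
    (G.map (SimplexCategory.const ⦋0⦌ n.unop 0).op).hom)
  naturality m n θ := by
    ext x
    have h := pi0_vertex_eq G (n := m.unop.len) x 0 (θ.unop.toOrderHom 0) (Fin.zero_le _)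
    have e : SimplexCategory.const ⦋0⦌ n.unop 0 ≫ θ.unop =
        SimplexCategory.const ⦋0⦌ m.unop (θ.unop.toOrderHom 0) := by
      ext k; rfl
    have h' : G.map (SimplexCategory.const ⦋0⦌ n.unop 0).op (G.map θ x) =
        G.map (SimplexCategory.const ⦋0⦌ m.unop (θ.unop.toOrderHom 0)).op x := by
      rw [← e, op_comp, G.map_comp]; rfl
    exact (congrArg QuotientGroup.mk h').trans h.symm

theorem pi0Kernel_le_ker {G : SimplicialObject GrpCat.{u}} {H : GrpCat.{u}}
    (f : G ⟶ discreteGrp.obj H) : pi0Kernel G ≤ (f.app (op ⦋0⦌)).hom.ker := by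
  refine Subgroup.normalClosure_le_normal ?_
  rintro x ⟨e, rfl⟩
  have h0 := ConcreteCategory.congr_hom (f.naturality (SimplexCategory.δ (0 : Fin 2)).op) e
  have h1 := ConcreteCategory.congr_hom (f.naturality (SimplexCategory.δ (1 : Fin 2)).op) e
  have h2 : (f.app (op ⦋0⦌)).hom (G.δ 0 e) = (f.app (op ⦋0⦌)).hom (G.δ 1 e) := h0.trans h1.symm
  change (f.app (op ⦋0⦌)).hom _ = 1
  rw [map_mul, map_inv, h2, mul_inv_cancel]

/-- `π₀` is left adjoint to `D`. -/
def pi0Adj : pi0Grp.{u} ⊣ discreteGrp.{u} :=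
  Adjunction.mkOfHomEquiv
    { homEquiv := fun G H =>
        { toFun := fun f => pi0Unit G ≫ discreteGrp.map f
          invFun := fun f => GrpCat.ofHom (QuotientGroup.lift _ (f.app (op ⦋0⦌)).hom
            (fun _ hx => pi0Kernel_le_ker f hx))
          left_inv := fun f => by
            refine ConcreteCategory.hom_ext _ _ fun x => ?_
            obtain ⟨x, rfl⟩ := QuotientGroup.mk_surjective x
            have e : SimplexCategory.const ⦋0⦌ ⦋0⦌ 0 = 𝟙 _ := by
              ext k; fin_cases k; rfl
            change f (QuotientGroup.mk (G.map (SimplexCategory.const ⦋0⦌ ⦋0⦌ 0).op x)) = _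
            rw [e, op_id, G.map_id]
            rfl
          right_inv := fun f => by
            ext n x
            exact ConcreteCategory.congr_hom
              (f.naturality (SimplexCategory.const ⦋0⦌ n.unop 0).op) x }
      homEquiv_naturality_left_symm := fun f g => by
        refine ConcreteCategory.hom_ext _ _ fun x => ?_
        obtain ⟨x, rfl⟩ := QuotientGroup.mk_surjective x
        rfl
      homEquiv_naturality_right := fun _ _ => rfl }

/-! ### The composite reflection -/

/-- The composite `π₀ ∘ S(I)` from simplicial loops to groups. -/
abbrev simplicialLoopReflector : SimplicialObject LoopCat.{u} ⥤ GrpCat.{u} :=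
  (SimplicialObject.whiskering _ _).obj loopToGrp ⋙ pi0Grp

/-- The inclusion `S(H) ∘ D` of groups in simplicial loops. -/
abbrev grpInclusion : GrpCat.{u} ⥤ SimplicialObject LoopCat.{u} :=
  discreteGrp ⋙ (SimplicialObject.whiskering _ _).obj grpToLoop

/-- The composite adjunction. -/
def reflectionAdj : simplicialLoopReflector.{u} ⊣ grpInclusion.{u} :=
  (loopGrpAdj.whiskerRight SimplexCategoryᵒᵖ).comp pi0Adj

/-! ### Normal extensions and the Galois group -/

section Galois

variable {𝒜 : Type*} [Category 𝒜] {ℬ : Type*} [Category ℬ]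

/-- Projectivity with respect to the class of regular epimorphisms. -/
def IsRegularProjective (P : 𝒜) : Prop :=
  ∀ ⦃X Y : 𝒜⦄ (e : X ⟶ Y) (f : P ⟶ Y), IsRegularEpi e → ∃ g : P ⟶ X, g ≫ e = f

/-- Trivial extensions with respect to a reflection `I ⊣ H`: regular epimorphisms whose naturality
square for the unit is a pullback. -/
structure IsTrivialExtension {I : 𝒜 ⥤ ℬ} {H : ℬ ⥤ 𝒜} (adj : I ⊣ H) {E B : 𝒜} (f : E ⟶ B) :
    Prop where
  isRegularEpi : IsRegularEpi f
  isPullback : IsPullback (adj.unit.app E) f (H.map (I.map f)) (adj.unit.app B)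

/-- Normal extensions: regular epimorphisms `p` whose pullback `p^*(p)` along itself is a trivial
extension. -/
structure IsNormalExtension [HasPullbacks 𝒜] {I : 𝒜 ⥤ ℬ} {H : ℬ ⥤ 𝒜} (adj : I ⊣ H) {E B : 𝒜}
    (p : E ⟶ B) : Prop where
  isRegularEpi : IsRegularEpi p
  isTrivial : IsTrivialExtension adj (pullback.fst p p)

/-- Weakly universal normal extensions of `B`. -/
structure IsWeaklyUniversalNormalExtension [HasPullbacks 𝒜] {I : 𝒜 ⥤ ℬ} {H : ℬ ⥤ 𝒜}
    (adj : I ⊣ H) {E B : 𝒜} (p : E ⟶ B) : Prop where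
  isNormal : IsNormalExtension adj p
  exists_hom : ∀ ⦃E' : 𝒜⦄ (p' : E' ⟶ B), IsNormalExtension adj p' → ∃ u : E ⟶ E', u ≫ p' = p

/-- The Galois group `Gal(E, p, 0)` with respect to a reflector `I` with values in groups: the
kernel of `⟨I(π₁), I(π₂)⟩ : I(E ×_B E) → I(E) × I(E)`. -/
noncomputable def galoisGroup [HasPullbacks 𝒜] (I : 𝒜 ⥤ GrpCat.{u}) {E B : 𝒜} (p : E ⟶ B) :
    GrpCat.{u} :=
  GrpCat.of (MonoidHom.ker
    ((I.map (pullback.fst p p)).hom.prod (I.map (pullback.snd p p)).hom))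

end Galois

/-! ### Normal subobjects of simplicial loops -/

/-- A normal subobject of a simplicial loop: a normal subloop in each degree, stable under the
simplicial operators. -/
@[ext]
structure NormalSub (A : SimplicialObject LoopCat.{u}) where
  /-- the degreewise normal subloops -/
  obj : ∀ n : SimplexCategoryᵒᵖ, NormalSubloop (A.obj n)
  map_mem : ∀ {m n : SimplexCategoryᵒᵖ} (θ : m ⟶ n) {x : A.obj m}, x ∈ obj m → A.map θ x ∈ obj n

namespace NormalSub

variable {A B : SimplicialObject LoopCat.{u}}

instance : LE (NormalSub A) := ⟨fun M N => ∀ n, ∀ x ∈ M.obj n, x ∈ N.obj n⟩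

/-- The intersection of a family of normal subobjects. -/
def sInf (S : Set (NormalSub A)) : NormalSub A where
  obj n := NormalSubloop.sInf {N | ∃ M ∈ S, N = M.obj n}
  map_mem θ x hx := by
    rintro _ ⟨M, hM, rfl⟩
    exact M.map_mem θ (hx _ ⟨M, hM, rfl⟩)

/-- The supremum `M ∨ N` of two normal subobjects: the smallest normal subobject that contains
both. -/
instance : Max (NormalSub A) := ⟨fun M N => sInf {T | M ≤ T ∧ N ≤ T}⟩

theorem le_sup_left (M N : NormalSub A) : M ≤ M ⊔ N := by
  rintro _ x hx _ ⟨T, hT, rfl⟩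
  exact hT.1 _ x hx

theorem le_sup_right (M N : NormalSub A) : N ≤ M ⊔ N := by
  rintro _ x hx _ ⟨T, hT, rfl⟩
  exact hT.2 _ x hx

theorem sup_le {M N T : NormalSub A} (h : M ≤ T) (h' : N ≤ T) : M ⊔ N ≤ T :=
  fun _ _ hx => hx _ ⟨T, ⟨h, h'⟩, rfl⟩

/-- `A` as a normal subobject of itself. -/
def top (A : SimplicialObject LoopCat.{u}) : NormalSub A where
  obj n := NormalSubloop.top (A.obj n)
  map_mem _ _ _ := NormalSubloop.mem_top _

/-- The inverse image of a normal subobject. -/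
def comap (f : A ⟶ B) (N : NormalSub B) : NormalSub A where
  obj n := (N.obj n).comap (f.app n).hom
  map_mem {m n} θ x hx := by
    have h := ConcreteCategory.congr_hom (f.naturality θ) x
    change f.app n (A.map θ x) ∈ N.obj n
    have h' : f.app n (A.map θ x) = B.map θ (f.app m x) := h
    rw [h']
    exact N.map_mem θ hx

/-- The kernel of a morphism of simplicial loops. -/
def ker (f : A ⟶ B) : NormalSub A where
  obj n := NormalSubloop.ker (f.app n).hom
  map_mem {m n} θ x hx := by
    have h : f.app n (A.map θ x) = B.map θ (f.app m x) :=
      ConcreteCategory.congr_hom (f.naturality θ) x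
    have hx' : f.app m x = f.app m 1 := hx
    change f.app n (A.map θ x) = f.app n 1
    rw [h, hx']
    simp

/-- A normal subobject as a simplicial loop. -/
def toSimplicial (N : NormalSub A) : SimplicialObject LoopCat.{u} where
  obj n := LoopCat.of {x // x ∈ N.obj n}
  map θ := LoopCat.ofHom
    { toFun := fun x => ⟨A.map θ x.1, N.map_mem θ x.2⟩
      map_one' := Subtype.ext (map_one (A.map θ).hom)
      map_mul' := fun x y => Subtype.ext (map_mul (A.map θ).hom x.1 y.1) }
  map_id n := by
    refine ConcreteCategory.hom_ext _ _ fun x => ?_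
    exact Subtype.ext (ConcreteCategory.congr_hom (A.map_id n) x.1)
  map_comp θ θ' := by
    refine ConcreteCategory.hom_ext _ _ fun x => ?_
    exact Subtype.ext (ConcreteCategory.congr_hom (A.map_comp θ θ') x.1)

/-- The inclusion of a normal subobject. -/
def ι (N : NormalSub A) : N.toSimplicial ⟶ A where
  app n := ConcreteCategory.ofHom (C := LoopCat) (X := LoopCat.of {x // x ∈ N.obj n})
    (Y := A.obj n) (N.obj n).subtype
  naturality _ _ _ := rfl

/-- The quotient `A/N` of a simplicial loop by a normal subobject. -/
def quotient (N : NormalSub A) : SimplicialObject LoopCat.{u} where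
  obj n := LoopCat.of (N.obj n).Quot
  map θ := LoopCat.ofHom
    (NormalSubloop.mapQuot _ _ (A.map θ).hom (fun _ h => N.map_mem θ h))
  map_id n := by
    ext x
    obtain ⟨x, rfl⟩ := NormalSubloop.toQuot_surjective _ x
    exact congrArg (N.obj n).toQuot (ConcreteCategory.congr_hom (A.map_id n) x)
  map_comp {_ _ n} θ θ' := by
    ext x
    obtain ⟨x, rfl⟩ := NormalSubloop.toQuot_surjective _ x
    exact congrArg (N.obj n).toQuot (ConcreteCategory.congr_hom (A.map_comp θ θ') x)

/-- The associator `[K, A, A]` of a normal subobject `K` of a simplicial loop `A`, defined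
degreewise. -/
def associator (K : NormalSub A) : NormalSub A where
  obj n := (K.obj n).associator
  map_mem θ _ hx := NormalSubloop.map_mem_associator (A.map θ).hom (fun _ h => K.map_mem θ h) hx

/-- Two vertices are joined by an edge. -/
def Joined (A : SimplicialObject LoopCat.{u}) (x y : A _⦋0⦌) : Prop :=
  ∃ e : A _⦋1⦌, A.δ 1 e = x ∧ A.δ 0 e = y

/-- Two vertices lie in the same connected component. -/
def SameComponent (A : SimplicialObject LoopCat.{u}) : A _⦋0⦌ → A _⦋0⦌ → Prop :=
  Relation.EqvGen (Joined A)

theorem sameComponent_equivalence (A : SimplicialObject LoopCat.{u}) :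
    Equivalence (SameComponent A) := Relation.EqvGen.is_equivalence _

theorem exists_degenerate (A : SimplicialObject LoopCat.{u}) (x : A _⦋0⦌) :
    ∃ s : A _⦋1⦌, A.δ 1 s = x ∧ A.δ 0 s = x :=
  ⟨A.σ 0 x, ConcreteCategory.congr_hom (A.δ_comp_σ_succ (i := (0 : Fin 1))) x,
    ConcreteCategory.congr_hom (A.δ_comp_σ_self (i := (0 : Fin 1))) x⟩

/-- An operation that commutes with the faces respects connected components. -/
theorem sameComponent_op (A : SimplicialObject LoopCat.{u}) (o₀ : A _⦋0⦌ → A _⦋0⦌ → A _⦋0⦌)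
    (o₁ : A _⦋1⦌ → A _⦋1⦌ → A _⦋1⦌)
    (h : ∀ (i : Fin 2) (a b : A _⦋1⦌), A.δ i (o₁ a b) = o₀ (A.δ i a) (A.δ i b))
    {a b c d : A _⦋0⦌} (hab : SameComponent A a b) (hcd : SameComponent A c d) :
    SameComponent A (o₀ a c) (o₀ b d) := by
  have h1 : SameComponent A (o₀ a c) (o₀ b c) := by
    obtain ⟨s, hs1, hs0⟩ := exists_degenerate A c
    induction hab with
    | rel x y hxy =>
      obtain ⟨e, rfl, rfl⟩ := hxy
      exact .rel _ _ ⟨o₁ e s, by rw [h, hs1], by rw [h, hs0]⟩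
    | refl x => exact .refl _
    | symm x y _ ih => exact .symm _ _ ih
    | trans x y z _ _ ih ih' => exact .trans _ _ _ ih ih'
  have h2 : SameComponent A (o₀ b c) (o₀ b d) := by
    obtain ⟨s, hs1, hs0⟩ := exists_degenerate A b
    clear h1
    induction hcd with
    | rel x y hxy =>
      obtain ⟨e, rfl, rfl⟩ := hxy
      exact .rel _ _ ⟨o₁ s e, by rw [h, hs1], by rw [h, hs0]⟩
    | refl x => exact .refl _
    | symm x y _ ih => exact .symm _ _ ih
    | trans x y z _ _ ih ih' => exact .trans _ _ _ ih ih'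
  exact .trans _ _ _ h1 h2

/-- The vertices in the connected component of `1`. -/
def componentVertices (A : SimplicialObject LoopCat.{u}) : NormalSubloop (A _⦋0⦌) :=
  NormalSubloop.ofCongruence (SameComponent A) (sameComponent_equivalence A)
    (fun h h' => sameComponent_op A (fun x y => x * y) (fun x y => x * y)
      (fun i a b => map_mul (A.δ i).hom a b) h h')
    (fun h h' => sameComponent_op A ldiv ldiv (fun i a b => map_ldiv (A.δ i).hom a b) h h')
    (fun h h' => sameComponent_op A rdiv rdiv (fun i a b => map_rdiv (A.δ i).hom a b) h h')

/-- The connected part `A₀` of a simplicial loop `A`: the connected component of `1`, consisting of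
all simplices whose vertices lie in the connected component of the vertex `1`. -/
def connectedPart (A : SimplicialObject LoopCat.{u}) : NormalSub A where
  obj n := NormalSubloop.sInf {N | ∃ v : n ⟶ op ⦋0⦌, N = (componentVertices A).comap (A.map v).hom}
  map_mem {m n} θ x hx := by
    rintro _ ⟨v, rfl⟩
    have h := hx _ ⟨θ ≫ v, rfl⟩
    have e : A.map v (A.map θ x) = A.map (θ ≫ v) x := by
      rw [A.map_comp]; rfl
    change A.map v (A.map θ x) ∈ componentVertices A
    rw [e]
    exact h

end NormalSub

/-! ### The two terms of the Hopf formula -/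

section Hopf

variable {P B : SimplicialObject LoopCat.{u}} (f : P ⟶ B)

/-- The kernel `K` of `f : P → B`, as a simplicial loop. -/
abbrev kernelObj : SimplicialObject LoopCat.{u} := (NormalSub.ker f).toSimplicial

/-- `K ∧ ([P,P,P] ∨ P₀)` as a normal subobject of `K`. -/
def hopfNumerator : NormalSub (kernelObj f) :=
  ((NormalSub.top P).associator ⊔ NormalSub.connectedPart P).comap (NormalSub.ker f).ι

/-- `[K,P,P] ∨ K₀` as a normal subobject of `K`. -/
def hopfDenominator : NormalSub (kernelObj f) :=
  (NormalSub.ker f).associator.comap (NormalSub.ker f).ι ⊔ NormalSub.connectedPart (kernelObj f)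

/-- The quotient `(K ∧ ([P,P,P] ∨ P₀)) / ([K,P,P] ∨ K₀)`. -/
def hopfQuotient : SimplicialObject LoopCat.{u} :=
  ((hopfDenominator f).comap (hopfNumerator f).ι).quotient

end Hopf

/-! ### Loops: images and products of normal subloops -/

namespace AlgLoop

variable {L : Type u} [AlgLoop L]

/-! Two facts about the reflection carry the proof. The kernel of the unit `A → DL(A)` is `[A,A,A] ∨
A₀` (`mem_associator_sup_connectedPart`): reaching a group kills associators, reaching a discrete
object kills the component of `1`. And normal extensions are exactly the surjections with central
kernel `K`, meaning that associators with an entry in `K` vanish and `K` is discrete (`IsCentral`).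

The second fact goes through a reformulation: a surjection is normal iff the only element `(1, k)`
of its kernel pair killed by the unit is the trivial one (`isNormalExtension_iff`). Normality gives
centrality because the associator of `(1, k)` with diagonal pairs is again of the form `(1, _)` and
is killed. Conversely, for central `p` the kernel pair acts on the kernel by `(x, y) l = (y l) / x`.
Centrality makes this a homomorphism to a permutation group that is constant along edges, so it
factors through the reflection; since `(1, k)` sends `1` to `k`, a killed `(1, k)` is trivial.

Now let `K` be the kernel of `f`. The centralization `P/([K,P,P] ∨ K₀) → B` is central, hence
normal, and every lift of `f` to a normal extension is trivial on `[K,P,P] ∨ K₀`. Projectivity of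
`P` then makes the centralization weakly universal.

For any weakly universal `p` and any lift `g : P → E` of `f`, the isomorphism is induced by sending
`k` to the class of `(1, g k)`. An element of the Galois group is the class of a pair `(x, y)` with
`x` and `y` killed by the unit; as `(x, y) = (1, y / x) (x, x)` and `(x, x)` is killed, `(1, y / x)`
represents the same class. Weak universality gives a map from `E` back to the centralization.
Morphisms over `B` into a normal extension agree on the kernel of the unit
(`app_eq_of_unitHom_eq_one`), so on these kernels the two extensions are interchangeable; this
yields both surjectivity and the kernel. -/

theorem rdiv_eq_one_iff {x y : L} : rdiv x y = 1 ↔ x = y := by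
  constructor
  · intro h
    rw [← rdiv_mul x y, h, one_mul]
  · rintro rfl
    exact rdiv_self x

/-- An associative loop is a group. -/
@[reducible] def groupOfAssoc (h : ∀ x y z : L, x * y * z = x * (y * z)) : Group L where
  mul_assoc := h
  one_mul := one_mul
  mul_one := mul_one
  inv a := rdiv 1 a
  inv_mul_cancel a := rdiv_mul 1 a

/-- The range of a homomorphism is a loop. -/
instance rangeLoop {M : Type u} [AlgLoop M] (f : L →* M) : AlgLoop (Set.range f) where
  mul a b := ⟨a.1 * b.1, by
    obtain ⟨_, a, rfl⟩ := a
    obtain ⟨_, b, rfl⟩ := b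
    exact ⟨a * b, map_mul f a b⟩⟩
  one := ⟨1, 1, map_one f⟩
  one_mul a := Subtype.ext (one_mul a.1)
  mul_one a := Subtype.ext (mul_one a.1)
  ldiv a b := ⟨ldiv a.1 b.1, by
    obtain ⟨_, a, rfl⟩ := a
    obtain ⟨_, b, rfl⟩ := b
    exact ⟨ldiv a b, map_ldiv f a b⟩⟩
  rdiv a b := ⟨rdiv a.1 b.1, by
    obtain ⟨_, a, rfl⟩ := a
    obtain ⟨_, b, rfl⟩ := b
    exact ⟨rdiv a b, map_rdiv f a b⟩⟩
  mul_ldiv a b := Subtype.ext (mul_ldiv a.1 b.1)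
  ldiv_mul a b := Subtype.ext (ldiv_mul a.1 b.1)
  rdiv_mul a b := Subtype.ext (rdiv_mul a.1 b.1)
  mul_rdiv a b := Subtype.ext (mul_rdiv a.1 b.1)

end AlgLoop

namespace NormalSubloop

variable {L M : Type u} [AlgLoop L] [AlgLoop M]

theorem mem_ker {f : L →* M} {x : L} : x ∈ ker f ↔ f x = 1 := by
  rw [← map_one f]; rfl

theorem assocElt_eq_one_iff {x y z : L} : assocElt x y z = 1 ↔ x * y * z = x * (y * z) :=
  rdiv_eq_one_iff

theorem toQuot_eq_one_iff (N : NormalSubloop L) {x : L} : N.toQuot x = 1 ↔ x ∈ N := by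
  refine ⟨fun h => ?_, N.toQuot_eq_one⟩
  rw [← map_one N.toQuot, eq_comm, toQuot_eq_toQuot] at h
  obtain ⟨n, hn, e⟩ := h
  rwa [e, one_mul]

/-- The image of a normal subloop under a surjective homomorphism. -/
def map (f : L →* M) (hf : Function.Surjective f) (N : NormalSubloop L) : NormalSubloop M where
  carrier := f '' N.carrier
  one_mem := ⟨1, N.one_mem, map_one f⟩
  mul_mem := by
    rintro _ _ ⟨a, ha, rfl⟩ ⟨b, hb, rfl⟩
    exact ⟨_, N.mul_mem ha hb, map_mul f a b⟩
  ldiv_mem := by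
    rintro _ _ ⟨a, ha, rfl⟩ ⟨b, hb, rfl⟩
    exact ⟨_, N.ldiv_mem ha hb, map_ldiv f a b⟩
  rdiv_mem := by
    rintro _ _ ⟨a, ha, rfl⟩ ⟨b, hb, rfl⟩
    exact ⟨_, N.rdiv_mem ha hb, map_rdiv f a b⟩
  innerT_mem := by
    rintro x _ ⟨a, ha, rfl⟩
    obtain ⟨x, rfl⟩ := hf x
    exact ⟨_, N.innerT_mem x ha, by simp [map_ldiv]⟩
  innerT_inv_mem := by
    rintro x _ ⟨a, ha, rfl⟩
    obtain ⟨x, rfl⟩ := hf x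
    exact ⟨_, N.innerT_inv_mem x ha, by simp [map_rdiv]⟩
  innerL_mem := by
    rintro x y _ ⟨a, ha, rfl⟩
    obtain ⟨x, rfl⟩ := hf x
    obtain ⟨y, rfl⟩ := hf y
    exact ⟨_, N.innerL_mem x y ha, by simp [map_ldiv]⟩
  innerL_inv_mem := by
    rintro x y _ ⟨a, ha, rfl⟩
    obtain ⟨x, rfl⟩ := hf x
    obtain ⟨y, rfl⟩ := hf y
    exact ⟨_, N.innerL_inv_mem x y ha, by simp [map_ldiv]⟩
  innerR_mem := by
    rintro x y _ ⟨a, ha, rfl⟩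
    obtain ⟨x, rfl⟩ := hf x
    obtain ⟨y, rfl⟩ := hf y
    exact ⟨_, N.innerR_mem x y ha, by simp [map_rdiv]⟩
  innerR_inv_mem := by
    rintro x y _ ⟨a, ha, rfl⟩
    obtain ⟨x, rfl⟩ := hf x
    obtain ⟨y, rfl⟩ := hf y
    exact ⟨_, N.innerR_inv_mem x y ha, by simp [map_rdiv]⟩

/-- The product `MN` of two normal subloops. -/
def prod (M N : NormalSubloop L) : NormalSubloop L :=
  (M.map N.toQuot N.toQuot_surjective).comap N.toQuot

theorem mem_prod {M N : NormalSubloop L} {x : L} :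
    x ∈ M.prod N ↔ ∃ m ∈ M, ∃ n ∈ N, x = m * n := by
  constructor
  · rintro ⟨m, hm, e⟩
    obtain ⟨n, hn, e⟩ := N.toQuot_eq_toQuot.1 e
    exact ⟨m, hm, n, hn, e⟩
  · rintro ⟨m, hm, n, hn, rfl⟩
    exact ⟨m, hm, N.toQuot_eq_toQuot.2 ⟨n, hn, rfl⟩⟩

end NormalSubloop

/-! ### Pullbacks of loops, elementwise -/

namespace LoopCat

/-- The comparison `i` with the explicit pullback of pairs has a one-sided inverse by uniqueness of
lifts, hence is injective. -/
theorem isPullback_ext {A B C D : LoopCat.{u}} {a : A ⟶ B} {b : A ⟶ C} {c : B ⟶ D} {d : C ⟶ D}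
    (h : IsPullback a b c d) {x y : A} (h1 : a x = a y) (h2 : b x = b y) : x = y := by
  let i : A ⟶ (pullbackCone c d).pt := PullbackCone.IsLimit.lift (pullbackConeIsLimit c d) a b h.w
  have hi : i ≫ h.lift _ _ (pullbackCone c d).condition = 𝟙 A := by
    refine h.hom_ext ?_ ?_
    · rw [Category.assoc, h.lift_fst, Category.id_comp]
      exact PullbackCone.IsLimit.lift_fst _ _ _ h.w
    · rw [Category.assoc, h.lift_snd, Category.id_comp]
      exact PullbackCone.IsLimit.lift_snd _ _ _ h.w
  have e : i x = i y := Subtype.ext (Prod.ext h1 h2)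
  have hx := ConcreteCategory.congr_hom hi x
  have hy := ConcreteCategory.congr_hom hi y
  rw [ConcreteCategory.comp_apply] at hx hy
  exact hx.symm.trans ((congrArg _ e).trans hy)

theorem isPullback_exists {A B C D : LoopCat.{u}} {a : A ⟶ B} {b : A ⟶ C} {c : B ⟶ D} {d : C ⟶ D}
    (h : IsPullback a b c d) (x : B) (y : C) (hxy : c x = d y) : ∃ z : A, a z = x ∧ b z = y :=
  ⟨h.lift _ _ (pullbackCone c d).condition (⟨(x, y), hxy⟩ : {x : B × C // c x.1 = d x.2}),
    ConcreteCategory.congr_hom (h.lift_fst _ _ (pullbackCone c d).condition) _,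
    ConcreteCategory.congr_hom (h.lift_snd _ _ (pullbackCone c d).condition) _⟩

/-- The preimages chosen from `hsurj` form a homomorphism because `hinj` determines them by their
two projections. -/
theorem isPullback_of_bijective {A B C D : LoopCat.{u}} {a : A ⟶ B} {b : A ⟶ C} {c : B ⟶ D}
    {d : C ⟶ D} (w : a ≫ c = b ≫ d) (hinj : ∀ x y : A, a x = a y → b x = b y → x = y)
    (hsurj : ∀ (x : B) (y : C), c x = d y → ∃ z : A, a z = x ∧ b z = y) :
    IsPullback a b c d := by
  refine ⟨⟨w⟩, ⟨PullbackCone.IsLimit.mk w (fun s => ?_) ?_ ?_ ?_⟩⟩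
  · have hs : ∀ t : s.pt, c (s.fst t) = d (s.snd t) := fun t =>
      ConcreteCategory.congr_hom s.condition t
    exact ConcreteCategory.ofHom (C := LoopCat) (X := s.pt) (Y := A)
      { toFun := fun t => (hsurj _ _ (hs t)).choose
        map_one' := by
          obtain ⟨h1, h2⟩ := (hsurj _ _ (hs 1)).choose_spec
          exact hinj _ _ (by rw [h1]; simp) (by rw [h2]; simp)
        map_mul' := fun t t' => by
          obtain ⟨h1, h2⟩ := (hsurj _ _ (hs (t * t'))).choose_spec
          obtain ⟨h3, h4⟩ := (hsurj _ _ (hs t)).choose_spec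
          obtain ⟨h5, h6⟩ := (hsurj _ _ (hs t')).choose_spec
          exact hinj _ _ (by rw [h1, map_mul, map_mul, h3, h5])
            (by rw [h2, map_mul, map_mul, h4, h6]) }
  · intro s
    refine ConcreteCategory.hom_ext _ _ fun t => ?_
    exact (hsurj _ _ (ConcreteCategory.congr_hom s.condition t)).choose_spec.1
  · intro s
    refine ConcreteCategory.hom_ext _ _ fun t => ?_
    exact (hsurj _ _ (ConcreteCategory.congr_hom s.condition t)).choose_spec.2
  · intro s m h1 h2
    refine ConcreteCategory.hom_ext _ _ fun t => ?_
    obtain ⟨h3, h4⟩ := (hsurj _ _ (ConcreteCategory.congr_hom s.condition t)).choose_spec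
    exact hinj _ _ ((ConcreteCategory.congr_hom h1 t).trans h3.symm)
      ((ConcreteCategory.congr_hom h2 t).trans h4.symm)

end LoopCat

/-! ### Simplicial loops, elementwise -/

namespace SimplicialLoop

variable {A B C : SimplicialObject LoopCat.{u}}

theorem app_map (f : A ⟶ B) {m n : SimplexCategoryᵒᵖ} (θ : m ⟶ n) (x : A.obj m) :
    f.app n (A.map θ x) = B.map θ (f.app m x) :=
  ConcreteCategory.congr_hom (f.naturality θ) x

theorem map_map {l m n : SimplexCategoryᵒᵖ} (θ : l ⟶ m) (θ' : m ⟶ n) (x : A.obj l) :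
    A.map θ' (A.map θ x) = A.map (θ ≫ θ') x := by
  rw [A.map_comp]; rfl

theorem comp_app_apply (f : A ⟶ B) (g : B ⟶ C) (n : SimplexCategoryᵒᵖ) (x : A.obj n) :
    (f ≫ g).app n x = g.app n (f.app n x) := rfl

theorem app_eq_of_comp_eq {f : A ⟶ B} {g : B ⟶ C} {h : A ⟶ C} (e : f ≫ g = h)
    (n : SimplexCategoryᵒᵖ) (x : A.obj n) : g.app n (f.app n x) = h.app n x := by
  rw [← e]; rfl

theorem hom_ext {f g : A ⟶ B} (h : ∀ n (x : A.obj n), f.app n x = g.app n x) : f = g := by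
  ext n x
  exact h n x

/-! ### Regular epimorphisms are the degreewise surjections -/

/-- The simplicial subloop that is the image of a morphism. -/
def image (f : A ⟶ B) : SimplicialObject LoopCat.{u} where
  obj n := LoopCat.of (Set.range (f.app n).hom)
  map {m n} θ := LoopCat.ofHom
    { toFun := fun x => ⟨B.map θ x.1, by
        obtain ⟨_, a, rfl⟩ := x
        exact ⟨A.map θ a, app_map f θ a⟩⟩
      map_one' := Subtype.ext (map_one (B.map θ).hom)
      map_mul' := fun x y => Subtype.ext (map_mul (B.map θ).hom x.1 y.1) }
  map_id n := by
    refine ConcreteCategory.hom_ext _ _ fun x => ?_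
    exact Subtype.ext (ConcreteCategory.congr_hom (B.map_id n) x.1)
  map_comp θ θ' := by
    refine ConcreteCategory.hom_ext _ _ fun x => ?_
    exact Subtype.ext (ConcreteCategory.congr_hom (B.map_comp θ θ') x.1)

/-- The inclusion of the image. -/
def imageι (f : A ⟶ B) : image f ⟶ B where
  app n := ConcreteCategory.ofHom (C := LoopCat) (X := LoopCat.of (Set.range (f.app n).hom))
    (Y := B.obj n) { toFun := fun x => x.1, map_one' := rfl, map_mul' := fun _ _ => rfl }
  naturality _ _ _ := rfl

/-- The corestriction to the image. -/
def toImage (f : A ⟶ B) : A ⟶ image f where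
  app n := ConcreteCategory.ofHom (C := LoopCat) (X := A.obj n)
    (Y := LoopCat.of (Set.range (f.app n).hom))
    { toFun := fun x => ⟨f.app n x, x, rfl⟩
      map_one' := Subtype.ext (map_one (f.app n).hom)
      map_mul' := fun x y => Subtype.ext (map_mul (f.app n).hom x y) }
  naturality _ _ θ := by
    refine ConcreteCategory.hom_ext _ _ fun x => ?_
    exact Subtype.ext (app_map f θ x)

/-- The pair coequalised by `f` is also coequalised by the corestriction to the image. The induced
morphism from `B` splits the inclusion of the image, so the image is everything. -/
theorem surjective_of_isRegularEpi {f : A ⟶ B} (hf : IsRegularEpi f) (n : SimplexCategoryᵒᵖ) :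
    Function.Surjective (f.app n) := by
  have hw : IsRegularEpi.left f ≫ toImage f = IsRegularEpi.right f ≫ toImage f := by
    refine hom_ext fun n x => Subtype.ext ?_
    exact ConcreteCategory.congr_hom (NatTrans.congr_app (IsRegularEpi.w f) n) x
  have h : IsRegularEpi.desc f (toImage f) hw ≫ imageι f = 𝟙 B := by
    rw [← cancel_epi f, ← Category.assoc, IsRegularEpi.fac, Category.comp_id]
    rfl
  intro b
  obtain ⟨a, ha⟩ := ((IsRegularEpi.desc f (toImage f) hw).app n b).2
  refine ⟨a, ha.trans ?_⟩
  exact ConcreteCategory.congr_hom (NatTrans.congr_app h n) b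

/-- A morphism that factors elementwise through a degreewise surjective one factors through it. -/
theorem exists_desc {f : A ⟶ B} (hf : ∀ n, Function.Surjective (f.app n)) (g : A ⟶ C)
    (h : ∀ n (x y : A.obj n), f.app n x = f.app n y → g.app n x = g.app n y) :
    ∃ d : B ⟶ C, f ≫ d = g := by
  have key : ∀ n (x : A.obj n), g.app n (Function.surjInv (hf n) (f.app n x)) = g.app n x :=
    fun n x => h n _ _ (Function.surjInv_eq (hf n) _)
  refine ⟨{ app := fun n => ConcreteCategory.ofHom (C := LoopCat) (X := B.obj n) (Y := C.obj n)
              { toFun := fun b => g.app n (Function.surjInv (hf n) b)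
                map_one' := ?_
                map_mul' := ?_ }
            naturality := ?_ }, ?_⟩
  · rw [← map_one (f.app n).hom]
    exact (key n 1).trans (map_one (g.app n).hom)
  · intro x y
    obtain ⟨x, rfl⟩ := hf n x
    obtain ⟨y, rfl⟩ := hf n y
    rw [← map_mul, key, key, key, map_mul]
  · intro m n θ
    refine ConcreteCategory.hom_ext _ _ fun b => ?_
    obtain ⟨a, rfl⟩ := hf m b
    change g.app n (Function.surjInv (hf n) (B.map θ (f.app m a))) =
      C.map θ (g.app m (Function.surjInv (hf m) (f.app m a)))
    rw [← app_map, key, key, app_map]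
  · exact hom_ext fun n x => key n x

theorem epi_of_surjective {f : A ⟶ B} (hf : ∀ n, Function.Surjective (f.app n)) : Epi f := by
  refine ⟨fun g h e => hom_ext fun n b => ?_⟩
  obtain ⟨a, rfl⟩ := hf n b
  exact ConcreteCategory.congr_hom (NatTrans.congr_app e n) a

theorem pullback_ext {p : A ⟶ C} {q : B ⟶ C} {n : SimplexCategoryᵒᵖ} {x y : (pullback p q).obj n}
    (h1 : (pullback.fst p q).app n x = (pullback.fst p q).app n y)
    (h2 : (pullback.snd p q).app n x = (pullback.snd p q).app n y) : x = y :=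
  LoopCat.isPullback_ext ((IsPullback.of_hasPullback p q).app n) h1 h2

theorem exists_pullback {p : A ⟶ C} {q : B ⟶ C} {n : SimplexCategoryᵒᵖ} (x : A.obj n) (y : B.obj n)
    (h : p.app n x = q.app n y) :
    ∃ z : (pullback p q).obj n, (pullback.fst p q).app n z = x ∧ (pullback.snd p q).app n z = y :=
  LoopCat.isPullback_exists ((IsPullback.of_hasPullback p q).app n) x y h

/-- A surjection is the coequaliser of its kernel pair, whose elements are all pairs with equal
image. -/
theorem isRegularEpi_of_surjective {f : A ⟶ B} (hf : ∀ n, Function.Surjective (f.app n)) :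
    IsRegularEpi f := by
  have := epi_of_surjective hf
  refine IsRegularEpi.of_epi_of_exists fun {Z} g hg => ?_
  refine exists_desc hf g fun n x y hxy => ?_
  obtain ⟨z, rfl, rfl⟩ := exists_pullback x y hxy
  exact ConcreteCategory.congr_hom (NatTrans.congr_app hg n) z

end SimplicialLoop

namespace SimplicialLoop

variable {A B C : SimplicialObject LoopCat.{u}}

/-! ### Connected components -/

/-- The initial vertex. -/
abbrev initialVertex (n : SimplexCategoryᵒᵖ) : n ⟶ op ⦋0⦌ := (SimplexCategory.const ⦋0⦌ n.unop 0).op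

/-- The totally degenerate simplices. -/
abbrev degenerate (n : SimplexCategoryᵒᵖ) : op ⦋0⦌ ⟶ n := (SimplexCategory.const n.unop ⦋0⦌ 0).op

theorem degenerate_comp (n : SimplexCategoryᵒᵖ) (v : n ⟶ op ⦋0⦌) : degenerate n ≫ v = 𝟙 _ := by
  apply Quiver.Hom.unop_inj
  exact SimplexCategory.isTerminalZero.hom_ext _ _

theorem map_degenerate (n : SimplexCategoryᵒᵖ) (v : n ⟶ op ⦋0⦌) (x : A _⦋0⦌) :
    A.map v (A.map (degenerate n) x) = x := by
  rw [map_map, degenerate_comp, A.map_id]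
  rfl

theorem map_initialVertex_zero (x : A _⦋0⦌) : A.map (initialVertex (op ⦋0⦌)) x = x := by
  have h : initialVertex (op ⦋0⦌) = 𝟙 _ :=
    Quiver.Hom.unop_inj (SimplexCategory.isTerminalZero.hom_ext _ _)
  rw [h, A.map_id]
  rfl

theorem δ_degenerate (i : Fin 2) (x : A _⦋0⦌) : A.δ i (A.map (degenerate (op ⦋1⦌)) x) = x :=
  map_degenerate _ _ x

open NormalSub

/-- Division supplies horn fillers, so being joined is already an equivalence relation. With `s` for
degenerate edges, an edge `e` from `x` to `y` is reversed by `(sx / e) (sy)`, and composed with `e'`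
from `y` by `(e / sy) e'`. -/
theorem joined_symm {x y : A _⦋0⦌} (h : Joined A x y) : Joined A y x := by
  obtain ⟨e, rfl, rfl⟩ := h
  refine ⟨rdiv (A.map (degenerate (op ⦋1⦌)) (A.δ 1 e)) e * A.map (degenerate (op ⦋1⦌)) (A.δ 0 e),
    ?_, ?_⟩
  · rw [map_mul, map_rdiv, δ_degenerate, δ_degenerate, rdiv_self, one_mul]
  · rw [map_mul, map_rdiv, δ_degenerate, δ_degenerate, rdiv_mul]

theorem joined_trans {x y z : A _⦋0⦌} (h : Joined A x y) (h' : Joined A y z) : Joined A x z := by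
  obtain ⟨e, rfl, rfl⟩ := h
  obtain ⟨e', h1, rfl⟩ := h'
  refine ⟨rdiv e (A.map (degenerate (op ⦋1⦌)) (A.δ 0 e)) * e', ?_, ?_⟩
  · rw [map_mul, map_rdiv, δ_degenerate, h1, rdiv_mul]
  · rw [map_mul, map_rdiv, δ_degenerate, rdiv_self, one_mul]

theorem sameComponent_iff_joined {x y : A _⦋0⦌} : SameComponent A x y ↔ Joined A x y := by
  refine ⟨fun h => ?_, fun h => .rel _ _ h⟩
  induction h with
  | rel x y h => exact h
  | refl x => exact exists_degenerate A x
  | symm x y _ ih => exact joined_symm ih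
  | trans x y z _ _ ih ih' => exact joined_trans ih ih'

theorem mem_componentVertices {x : A _⦋0⦌} :
    x ∈ componentVertices A ↔ ∃ e : A _⦋1⦌, A.δ 1 e = 1 ∧ A.δ 0 e = x := by
  change SameComponent A x 1 ↔ _
  rw [sameComponent_iff_joined]
  exact ⟨joined_symm, joined_symm⟩

theorem mem_connectedPart {n : SimplexCategoryᵒᵖ} {x : A.obj n} :
    x ∈ (connectedPart A).obj n ↔ ∀ v : n ⟶ op ⦋0⦌, A.map v x ∈ componentVertices A := by
  constructor
  · intro h v
    exact h _ ⟨v, rfl⟩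
  · rintro h _ ⟨v, rfl⟩
    exact h v

/-- This operator extracts from every simplex an edge joining its initial vertex to a prescribed
one, so the component of a simplex can be read off its initial vertex. -/
theorem exists_edge (n : SimplexCategoryᵒᵖ) (v : n ⟶ op ⦋0⦌) :
    ∃ e : n ⟶ op ⦋1⦌, e ≫ (SimplexCategory.δ (1 : Fin 2)).op = initialVertex n ∧
      e ≫ (SimplexCategory.δ (0 : Fin 2)).op = v := by
  refine ⟨(SimplexCategory.mkOfLe (n := n.unop.len) 0 (v.unop.toOrderHom 0) (Fin.zero_le _)).op,
    ?_, ?_⟩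
  · apply Quiver.Hom.unop_inj
    ext k; fin_cases k; rfl
  · apply Quiver.Hom.unop_inj
    ext k; fin_cases k; rfl

/-- A simplex is in the connected part as soon as its initial vertex is. -/
theorem mem_connectedPart_of_initialVertex {n : SimplexCategoryᵒᵖ} {x : A.obj n}
    (h : A.map (initialVertex n) x ∈ componentVertices A) : x ∈ (connectedPart A).obj n := by
  rw [mem_connectedPart]
  intro v
  obtain ⟨e, h1, h0⟩ := exists_edge n v
  refine (sameComponent_equivalence A).trans (.symm _ _ (.rel _ _ ⟨A.map e x, ?_, ?_⟩)) h
  · exact (map_map _ _ x).trans (by rw [h1])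
  · exact (map_map _ _ x).trans (by rw [h0])

/-! ### The unit of the reflection -/

/-- The unit of the reflection in degree `n`, with values in the reflected group. -/
def unitHom (A : SimplicialObject LoopCat.{u}) (n : SimplexCategoryᵒᵖ) :
    A.obj n →* simplicialLoopReflector.obj A :=
  (QuotientGroup.mk' (pi0Kernel (((SimplicialObject.whiskering _ _).obj loopToGrp).obj A))).comp
    ((NormalSubloop.toQuot _).comp (A.map (initialVertex n)).hom)

/-- The target of the unit is discrete, so a simplex has the same class as each of its vertices. -/
theorem unitHom_map {m n : SimplexCategoryᵒᵖ} (θ : m ⟶ n) (x : A.obj m) :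
    unitHom A n (A.map θ x) = unitHom A m x :=
  app_map (reflectionAdj.unit.app A) θ x

theorem unitHom_app (f : A ⟶ B) {n : SimplexCategoryᵒᵖ} (x : A.obj n) :
    unitHom B n (f.app n x) = simplicialLoopReflector.map f (unitHom A n x) :=
  ConcreteCategory.congr_hom (NatTrans.congr_app (reflectionAdj.unit.naturality f) n) x

theorem unitHom_app_eq_one (f : A ⟶ B) {n : SimplexCategoryᵒᵖ} {x : A.obj n}
    (hx : unitHom A n x = 1) : unitHom B n (f.app n x) = 1 := by
  rw [unitHom_app, hx, map_one]

theorem unitHom_surjective (n : SimplexCategoryᵒᵖ) : Function.Surjective (unitHom A n) := by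
  intro g
  obtain ⟨y, rfl⟩ := QuotientGroup.mk_surjective g
  obtain ⟨x, rfl⟩ := NormalSubloop.toQuot_surjective _ y
  refine ⟨A.map (degenerate n) x, ?_⟩
  exact congrArg (fun t => QuotientGroup.mk (NormalSubloop.toQuot _ t))
    (map_degenerate n (initialVertex n) x)

theorem unitHom_rdiv {n : SimplexCategoryᵒᵖ} (x y : A.obj n) :
    unitHom A n (rdiv x y) = unitHom A n x * (unitHom A n y)⁻¹ := by
  rw [eq_mul_inv_iff_mul_eq, ← map_mul, rdiv_mul]

theorem unitHom_assocElt {n : SimplexCategoryᵒᵖ} (x y z : A.obj n) :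
    unitHom A n (NormalSubloop.assocElt x y z) = 1 := by
  rw [NormalSubloop.assocElt, unitHom_rdiv]
  simp [mul_assoc]

/-- A homomorphism from the vertices to a group that identifies the endpoints of all edges
factors through the unit. -/
theorem eq_one_of_unitHom_eq_one {G : Type u} [Group G] (φ : A _⦋0⦌ →* G)
    (hφ : ∀ e : A _⦋1⦌, φ (A.δ 0 e) = φ (A.δ 1 e)) {x : A _⦋0⦌}
    (hx : unitHom A (op ⦋0⦌) x = 1) : φ x = 1 := by
  -- A group target kills associators, so `φ` descends to the group reflection of the vertices; `hφ`
  -- then makes it kill the generators of `pi0Kernel`.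
  let ψ : (((SimplicialObject.whiskering _ _).obj loopToGrp).obj A) _⦋0⦌ →* G :=
    let _ := AlgLoop.ofGroup G
    NormalSubloop.lift _ φ (fun _ h => map_associator_eq_one φ h)
  have hψ : pi0Kernel (((SimplicialObject.whiskering _ _).obj loopToGrp).obj A) ≤ ψ.ker := by
    refine Subgroup.normalClosure_le_normal ?_
    rintro _ ⟨e, rfl⟩
    obtain ⟨e, rfl⟩ := NormalSubloop.toQuot_surjective _ e
    change ψ (_ * _⁻¹) = 1
    rw [map_mul, map_inv, mul_inv_eq_one]
    exact hφ e
  have h1 := hψ ((QuotientGroup.eq_one_iff _).1 hx)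
  change φ (A.map (initialVertex (op ⦋0⦌)) x) = 1 at h1
  rwa [map_initialVertex_zero] at h1

/-- The kernel of the unit is `[A,A,A] ∨ A₀`. -/
theorem mem_associator_sup_connectedPart {n : SimplexCategoryᵒᵖ} {x : A.obj n} :
    x ∈ ((NormalSub.top A).associator ⊔ connectedPart A).obj n ↔ unitHom A n x = 1 := by
  set T := (NormalSub.top A).associator ⊔ connectedPart A with hT
  constructor
  · intro hx
    have h : T ≤ NormalSub.ker (reflectionAdj.unit.app A) := by
      refine NormalSub.sup_le ?_ ?_
      · intro m y hy
        refine NormalSubloop.normalClosure_le ?_ hy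
        rintro a ⟨k, y, z, -, h⟩
        refine NormalSubloop.mem_ker.2 ?_
        rcases h with rfl | rfl | rfl <;> exact unitHom_assocElt _ _ _
      · intro m y hy
        refine NormalSubloop.mem_ker.2 ?_
        change unitHom A m y = 1
        obtain ⟨e, h1, h0⟩ := mem_componentVertices.1 (mem_connectedPart.1 hy (initialVertex m))
        rw [← unitHom_map (initialVertex m), ← h0]
        refine (unitHom_map _ e).trans ?_
        refine (unitHom_map (SimplexCategory.δ (1 : Fin 2)).op e).symm.trans ?_
        exact (congrArg _ h1).trans (map_one _)
    exact NormalSubloop.mem_ker.1 (h n x hx)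
  · intro hx
    -- The vertices modulo `T` form a group in which the two ends of an edge coincide. The
    -- projection to it therefore factors through the unit, which puts the initial vertex of `x` in
    -- `T`.
    have hassoc : ∀ a b c : (T.obj (op ⦋0⦌)).Quot, a * b * c = a * (b * c) := by
      intro a b c
      obtain ⟨a, rfl⟩ := NormalSubloop.toQuot_surjective _ a
      obtain ⟨b, rfl⟩ := NormalSubloop.toQuot_surjective _ b
      obtain ⟨c, rfl⟩ := NormalSubloop.toQuot_surjective _ c
      rw [← NormalSubloop.assocElt_eq_one_iff, ← NormalSubloop.map_assocElt,
        NormalSubloop.toQuot_eq_one_iff]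
      refine NormalSub.le_sup_left _ _ _ _ (NormalSubloop.subset_normalClosure _ ?_)
      exact ⟨a, b, c, NormalSubloop.mem_top a, Or.inl rfl⟩
    let _ := groupOfAssoc hassoc
    have h0 : A.map (initialVertex n) x ∈ T.obj (op ⦋0⦌) := by
      rw [← NormalSubloop.toQuot_eq_one_iff]
      refine eq_one_of_unitHom_eq_one (G := (T.obj (op ⦋0⦌)).Quot) _ (fun e => ?_)
        ((unitHom_map _ x).trans hx)
      rw [← rdiv_eq_one_iff, ← AlgLoop.map_rdiv, NormalSubloop.toQuot_eq_one_iff]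
      refine NormalSub.le_sup_right _ _ _ _ (mem_connectedPart_of_initialVertex ?_)
      refine mem_componentVertices.2 ?_
      -- Dividing `e` by the degenerate edge on its source gives an edge from `1` to the quotient of
      -- the two ends.
      refine ⟨rdiv e (A.map (degenerate (op ⦋1⦌)) (A.δ 1 e)), ?_, ?_⟩
      · rw [AlgLoop.map_rdiv, δ_degenerate, rdiv_self]
      · rw [AlgLoop.map_rdiv, δ_degenerate, map_initialVertex_zero]
    -- Divided by the degenerate simplex on its initial vertex, `x` starts at `1` and so lies in the
    -- connected part.
    have h1 : rdiv x (A.map (degenerate n) (A.map (initialVertex n) x)) ∈ T.obj n := by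
      refine NormalSub.le_sup_right _ _ _ _ (mem_connectedPart_of_initialVertex ?_)
      rw [AlgLoop.map_rdiv, map_degenerate, rdiv_self]
      exact NormalSubloop.one_mem _
    have := (T.obj n).mul_mem h1 (T.map_mem (degenerate n) h0)
    rwa [rdiv_mul] at this

end SimplicialLoop

namespace SimplicialLoop

variable {A B E : SimplicialObject LoopCat.{u}}

open NormalSub

/-! ### Normal extensions are central extensions -/

theorem fst_app_eq_snd_app {p : E ⟶ B} {n : SimplexCategoryᵒᵖ} (z : (pullback p p).obj n) :
    p.app n ((pullback.fst p p).app n z) = p.app n ((pullback.snd p p).app n z) :=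
  ConcreteCategory.congr_hom (NatTrans.congr_app (pullback.condition (f := p) (g := p)) n) z

/-- If the kernel of the first projection of the kernel pair meets the kernel of the unit trivially,
then two morphisms over `B` agree on the kernel of the unit. -/
theorem app_eq_of_unitHom_eq_one {p : E ⟶ B}
    (hp : ∀ n (z : (pullback p p).obj n), (pullback.fst p p).app n z = 1 →
      unitHom (pullback p p) n z = 1 → (pullback.snd p p).app n z = 1)
    (u v : A ⟶ E) (h : u ≫ p = v ≫ p) {n : SimplexCategoryᵒᵖ} {x : A.obj n}
    (hx : unitHom A n x = 1) : u.app n x = v.app n x := by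
  have h1 := unitHom_app_eq_one (pullback.lift u v h) hx
  have h2 := unitHom_app_eq_one (pullback.lift u u (rfl : u ≫ p = u ≫ p)) hx
  have e1 := app_eq_of_comp_eq (pullback.lift_fst u v h) n x
  have e2 := app_eq_of_comp_eq (pullback.lift_snd u v h) n x
  have e3 := app_eq_of_comp_eq (pullback.lift_fst u u (rfl : u ≫ p = u ≫ p)) n x
  have e4 := app_eq_of_comp_eq (pullback.lift_snd u u (rfl : u ≫ p = u ≫ p)) n x
  -- The pairs `(u x, v x)` and `(u x, u x)` are both killed by the unit because `x` is, and their
  -- quotient has first entry `1`.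
  have := hp n (rdiv ((pullback.lift u v h).app n x)
      ((pullback.lift u u (rfl : u ≫ p = u ≫ p)).app n x)) (by
    rw [AlgLoop.map_rdiv, e1, e3, rdiv_self]) (by rw [unitHom_rdiv, h1, h2]; simp)
  rw [AlgLoop.map_rdiv, e2, e4, rdiv_eq_one_iff] at this
  exact this.symm

/-- The condition on `(1, k)` is the uniqueness half of the pullback property. The existence half is
automatic, since the diagonal splits the first projection. -/
theorem isNormalExtension_iff {p : E ⟶ B} :
    IsNormalExtension reflectionAdj p ↔ (∀ n, Function.Surjective (p.app n)) ∧
      ∀ n (z : (pullback p p).obj n), (pullback.fst p p).app n z = 1 →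
        unitHom (pullback p p) n z = 1 → (pullback.snd p p).app n z = 1 := by
  constructor
  · rintro ⟨h1, h2⟩
    refine ⟨surjective_of_isRegularEpi h1, fun n z hz hz' => ?_⟩
    have : z = 1 := LoopCat.isPullback_ext (h2.isPullback.app n)
      (hz'.trans (map_one (unitHom (pullback p p) n)).symm)
      (hz.trans (map_one ((pullback.fst p p).app n).hom).symm)
    rw [this, map_one]
  · rintro ⟨h1, h2⟩
    have hdiag (n) (r : E.obj n) : ∃ z : (pullback p p).obj n, (pullback.fst p p).app n z = r ∧
        (unitHom E n r = 1 → unitHom (pullback p p) n z = 1) := by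
      refine ⟨(pullback.lift (𝟙 E) (𝟙 E) rfl).app n r, ?_, unitHom_app_eq_one _⟩
      exact app_eq_of_comp_eq (pullback.lift_fst (𝟙 E) (𝟙 E) (rfl : _ ≫ p = _ ≫ p)) n r
    refine ⟨isRegularEpi_of_surjective h1, isRegularEpi_of_surjective fun n r => ?_, ?_⟩
    · obtain ⟨z, hz, -⟩ := hdiag n r
      exact ⟨z, hz⟩
    · refine IsPullback.of_forall_isPullback_app fun n => ?_
      refine LoopCat.isPullback_of_bijective ?_ ?_ ?_
      · exact NatTrans.congr_app (reflectionAdj.unit.naturality (pullback.fst p p)).symm n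
      · intro x y h3 h4
        change unitHom (pullback p p) n x = unitHom (pullback p p) n y at h3
        refine pullback_ext h4 ?_
        have := h2 n (rdiv x y) (by rw [AlgLoop.map_rdiv, h4, rdiv_self])
          (by rw [unitHom_rdiv, h3, mul_inv_cancel])
        rwa [AlgLoop.map_rdiv, rdiv_eq_one_iff] at this
      · intro g x hgx
        obtain ⟨w, rfl⟩ := unitHom_surjective (A := pullback p p) n g
        have e : unitHom E n ((pullback.fst p p).app n w) = unitHom E n x :=
          (unitHom_app (pullback.fst p p) w).trans hgx
        -- A diagonal element killed by the unit corrects the first entry of `w` without changing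
        -- its class.
        obtain ⟨d, hd, hd'⟩ := hdiag n (rdiv x ((pullback.fst p p).app n w))
        refine ⟨d * w, ?_, ?_⟩
        · change unitHom (pullback p p) n (d * w) = unitHom (pullback p p) n w
          rw [map_mul, hd' (by rw [unitHom_rdiv, e, mul_inv_cancel]), one_mul]
        · rw [map_mul, hd, rdiv_mul]

/-- A morphism is central when all associators with an entry in the kernel are trivial and the
kernel is discrete. -/
structure IsCentral (p : E ⟶ B) : Prop where
  assoc : ∀ n, ∀ a ∈ NormalSubloop.assocSet ((NormalSub.ker p).obj n), a = 1
  discrete : ∀ n (k : E.obj n), p.app n k = 1 → E.map (initialVertex n) k = 1 → k = 1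

/-! ### Central extensions are normal -/

namespace IsCentral

variable {p : E ⟶ B}

/-- An edge of the kernel divided by the degenerate edge on its source starts at `1`, so
discreteness makes the quotient trivial and the edge degenerate. -/
theorem δ_eq (hp : IsCentral p) {e : E _⦋1⦌} (he : p.app _ e = 1) : E.δ 0 e = E.δ 1 e := by
  have h : rdiv e (E.map (degenerate (op ⦋1⦌)) (E.map (initialVertex (op ⦋1⦌)) e)) = 1 := by
    refine hp.discrete _ _ ?_ ?_
    · rw [AlgLoop.map_rdiv, app_map, app_map, he]
      simp
    · rw [AlgLoop.map_rdiv, map_degenerate, rdiv_self]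
  rw [rdiv_eq_one_iff] at h
  rw [h, δ_degenerate, δ_degenerate]

theorem mul_assoc_left (hp : IsCentral p) {n} {k : E.obj n} (hk : p.app n k = 1) (x y : E.obj n) :
    k * x * y = k * (x * y) :=
  NormalSubloop.assocElt_eq_one_iff.1
    (hp.assoc n _ ⟨k, x, y, NormalSubloop.mem_ker.2 hk, Or.inl rfl⟩)

theorem mul_assoc_middle (hp : IsCentral p) {n} {k : E.obj n} (hk : p.app n k = 1) (x y : E.obj n) :
    x * k * y = x * (k * y) :=
  NormalSubloop.assocElt_eq_one_iff.1
    (hp.assoc n _ ⟨k, x, y, NormalSubloop.mem_ker.2 hk, Or.inr (Or.inl rfl)⟩)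

theorem mul_assoc_right (hp : IsCentral p) {n} {k : E.obj n} (hk : p.app n k = 1) (x y : E.obj n) :
    x * y * k = x * (y * k) :=
  NormalSubloop.assocElt_eq_one_iff.1
    (hp.assoc n _ ⟨k, x, y, NormalSubloop.mem_ker.2 hk, Or.inr (Or.inr rfl)⟩)

theorem app_rdiv_mul {n} (z : (pullback p p).obj n) {l : E.obj n} (hl : p.app n l = 1) :
    p.app n (rdiv ((pullback.snd p p).app n z * l) ((pullback.fst p p).app n z)) = 1 := by
  rw [AlgLoop.map_rdiv, map_mul, hl, mul_one, fst_app_eq_snd_app, rdiv_self]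

/-- The vertices of the kernel pair of a central morphism act on the vertices of the kernel by
`(x, y) l = (y l) / x`. -/
noncomputable def kernelAction (hp : IsCentral p) :
    (pullback p p) _⦋0⦌ →* Equiv.Perm {l : E _⦋0⦌ // p.app (op ⦋0⦌) l = 1} where
  toFun z :=
    { toFun := fun l => ⟨_, app_rdiv_mul z l.2⟩
      invFun := fun l => ⟨ldiv ((pullback.snd p p).app _ z) (l.1 * (pullback.fst p p).app _ z), by
        rw [AlgLoop.map_ldiv, map_mul, l.2, one_mul, fst_app_eq_snd_app, ldiv_self]⟩
      left_inv := fun l => Subtype.ext (by simp)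
      right_inv := fun l => Subtype.ext (by simp) }
  map_one' := Equiv.ext fun l => Subtype.ext (by
    change rdiv ((pullback.snd p p).app _ 1 * l.1) ((pullback.fst p p).app _ 1) = l.1
    rw [map_one, map_one, one_mul]
    simpa using mul_rdiv l.1 1)
  -- For `z = (x, y)`, `w = (x', y')` and `m = (y' l) / x'`, the point is `(y y') l = y (y' l) = y
  -- (m x') = (y m) x' = ((y m) / x) (x x')`. Each of the three associativity laws for kernel
  -- elements is used once.
  map_mul' z w := Equiv.ext fun l => Subtype.ext (by
    change rdiv ((pullback.snd p p).app _ (z * w) * l.1) ((pullback.fst p p).app _ (z * w)) =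
      rdiv ((pullback.snd p p).app _ z *
        rdiv ((pullback.snd p p).app _ w * l.1) ((pullback.fst p p).app _ w))
        ((pullback.fst p p).app _ z)
    have h1 := app_rdiv_mul w l.2
    apply mul_right_cancel' (z := (pullback.fst p p).app _ (z * w))
    rw [rdiv_mul, map_mul, map_mul, hp.mul_assoc_right l.2,
      ← hp.mul_assoc_left (app_rdiv_mul z h1), rdiv_mul, hp.mul_assoc_middle h1, rdiv_mul])

theorem kernelAction_apply (hp : IsCentral p) (z : (pullback p p) _⦋0⦌)
    (l : {l : E _⦋0⦌ // p.app (op ⦋0⦌) l = 1}) :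
    (hp.kernelAction z l).1 =
      rdiv ((pullback.snd p p).app _ z * l.1) ((pullback.fst p p).app _ z) := rfl

/-- Letting `e` act on the degenerate edge at `l` gives an edge of the kernel whose ends are the two
values to be compared; in a discrete kernel these ends coincide. -/
theorem kernelAction_δ (hp : IsCentral p) (e : (pullback p p) _⦋1⦌) :
    hp.kernelAction ((pullback p p).δ 0 e) = hp.kernelAction ((pullback p p).δ 1 e) := by
  refine Equiv.ext fun l => Subtype.ext ?_
  have h : p.app _ (E.map (degenerate (op ⦋1⦌)) l.1) = 1 := by
    rw [app_map, l.2, map_one]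
  have key (i : Fin 2) : (hp.kernelAction ((pullback p p).δ i e) l).1 =
      E.δ i (rdiv ((pullback.snd p p).app _ e * E.map (degenerate (op ⦋1⦌)) l.1)
        ((pullback.fst p p).app _ e)) := by
    rw [AlgLoop.map_rdiv, map_mul, δ_degenerate, kernelAction_apply]
    exact congrArg₂ (fun a b => rdiv (a * l.1) b) (app_map (pullback.snd p p) _ e)
      (app_map (pullback.fst p p) _ e)
  rw [key, key, hp.δ_eq (app_rdiv_mul e h)]

/-- The action factors through the unit, so a killed `(1, k)` has an initial vertex acting
trivially. That vertex sends `1` to the initial vertex of `k`, which is thus `1`, and discreteness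
gives `k = 1`. -/
theorem isNormalExtension (hp : IsCentral p) (hs : ∀ n, Function.Surjective (p.app n)) :
    IsNormalExtension reflectionAdj p := by
  refine isNormalExtension_iff.2 ⟨hs, fun n z h1 h2 => ?_⟩
  have hz := eq_one_of_unitHom_eq_one hp.kernelAction hp.kernelAction_δ
    ((unitHom_map (initialVertex n) z).trans h2)
  refine hp.discrete n _ (by rw [← fst_app_eq_snd_app, h1, map_one]) ?_
  have := congrArg Subtype.val (Equiv.congr_fun hz ⟨1, map_one (p.app _).hom⟩)
  rw [kernelAction_apply, app_map, app_map, h1, map_one, mul_one] at this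
  rw [← mul_rdiv (E.map _ _) 1, mul_one]
  exact this

end IsCentral

/-- Normal extensions are central. -/
theorem isCentral_of_isNormalExtension {p : E ⟶ B} (hp : IsNormalExtension reflectionAdj p) :
    IsCentral p := by
  obtain ⟨-, hp⟩ := isNormalExtension_iff.1 hp
  have hpair {n} {k : E.obj n} (hk : k ∈ (NormalSub.ker p).obj n) :=
    exists_pullback (p := p) (q := p) 1 k
      ((map_one (p.app n).hom).trans (NormalSubloop.mem_ker.1 hk).symm)
  have hdiag {n} (x : E.obj n) := exists_pullback (p := p) (q := p) x x rfl
  refine ⟨?_, ?_⟩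
  · rintro n _ ⟨k, x, y, hk, h⟩
    obtain ⟨k', hk1, hk2⟩ := hpair hk
    obtain ⟨x', hx1, hx2⟩ := hdiag x
    obtain ⟨y', hy1, hy2⟩ := hdiag y
    -- An associator with entry `(1, k)` has first entry `1`, and the unit kills all associators.
    have h1 := hp n (NormalSubloop.assocElt k' x' y')
      (by rw [NormalSubloop.map_assocElt, hk1, NormalSubloop.assocElt]; simp)
      (unitHom_assocElt _ _ _)
    have h2 := hp n (NormalSubloop.assocElt x' k' y')
      (by rw [NormalSubloop.map_assocElt, hk1, NormalSubloop.assocElt]; simp)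
      (unitHom_assocElt _ _ _)
    have h3 := hp n (NormalSubloop.assocElt x' y' k')
      (by rw [NormalSubloop.map_assocElt, hk1, NormalSubloop.assocElt]; simp)
      (unitHom_assocElt _ _ _)
    rw [NormalSubloop.map_assocElt, hk2, hx2, hy2] at h1 h2 h3
    rcases h with rfl | rfl | rfl
    exacts [h1, h2, h3]
  · intro n k hk hv
    obtain ⟨z, h1, h2⟩ := hpair (NormalSubloop.mem_ker.2 hk)
    rw [← h2]
    refine hp n z h1 ?_
    -- The unit sees only the initial vertex, and that of `(1, k)` is `(1, 1)`.
    rw [← unitHom_map (initialVertex n)]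
    have : (pullback p p).map (initialVertex n) z = 1 := by
      refine pullback_ext ?_ ?_
      · rw [app_map, h1]; simp
      · rw [app_map, h2, hv]; simp
    rw [this, map_one]

end SimplicialLoop

/-! ### Quotients and the first isomorphism theorem -/

namespace NormalSub

open SimplicialLoop

variable {A B X : SimplicialObject LoopCat.{u}}

/-- The quotient morphism `A → A/N`. -/
def quotientMap (N : NormalSub A) : A ⟶ N.quotient where
  app n := ConcreteCategory.ofHom (C := LoopCat) (X := A.obj n) (Y := LoopCat.of (N.obj n).Quot)
    (N.obj n).toQuot
  naturality _ _ _ := rfl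

theorem quotientMap_surjective (N : NormalSub A) (n : SimplexCategoryᵒᵖ) :
    Function.Surjective (N.quotientMap.app n) :=
  (N.obj n).toQuot_surjective

theorem quotientMap_eq_one_iff (N : NormalSub A) {n : SimplexCategoryᵒᵖ} {x : A.obj n} :
    N.quotientMap.app n x = 1 ↔ x ∈ N.obj n :=
  (N.obj n).toQuot_eq_one_iff

theorem exists_desc_of_ker {f : A ⟶ B} (hf : ∀ n, Function.Surjective (f.app n)) (g : A ⟶ X)
    (h : ∀ n (x : A.obj n), f.app n x = 1 → g.app n x = 1) : ∃ d : B ⟶ X, f ≫ d = g := by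
  refine exists_desc hf g fun n x y hxy => ?_
  have := h n (rdiv x y) (by rw [AlgLoop.map_rdiv, hxy, rdiv_self])
  rwa [AlgLoop.map_rdiv, rdiv_eq_one_iff] at this

/-- The first isomorphism theorem. -/
theorem nonempty_iso_quotient (N : NormalSub A) (f : A ⟶ X)
    (hf : ∀ n, Function.Surjective (f.app n))
    (h : ∀ n (x : A.obj n), f.app n x = 1 ↔ x ∈ N.obj n) : Nonempty (X ≅ N.quotient) := by
  obtain ⟨d, hd⟩ := exists_desc_of_ker hf N.quotientMap
    fun n x hx => N.quotientMap_eq_one_iff.2 ((h n x).1 hx)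
  obtain ⟨d', hd'⟩ := exists_desc_of_ker N.quotientMap_surjective f
    fun n x hx => (h n x).2 (N.quotientMap_eq_one_iff.1 hx)
  have := epi_of_surjective hf
  have := epi_of_surjective N.quotientMap_surjective
  refine ⟨⟨d, d', ?_, ?_⟩⟩
  · rw [← cancel_epi f, ← Category.assoc, hd, hd', Category.comp_id]
  · rw [← cancel_epi N.quotientMap, ← Category.assoc, hd', hd, Category.comp_id]

end NormalSub

namespace SimplicialLoop

open NormalSub

/-! ### The centralization of an extension -/

section

variable {P B : SimplicialObject LoopCat.{u}} (f : P ⟶ B)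

theorem δ_surjective (i : Fin 2) : Function.Surjective (P.δ (n := 0) i) :=
  fun x => ⟨_, δ_degenerate i x⟩

/-- The vertices in the connected component of `1` in the kernel of `f`, as a normal subloop of the
vertices of the domain. -/
def kernelComponentVertices : NormalSubloop (P _⦋0⦌) :=
  -- Ends of the edges of the kernel that start at `1`. Being the image of a normal subloop of `P
  -- _⦋1⦌` under a surjection, this is normal among the vertices of `P`, not only among those of the
  -- kernel.
  NormalSubloop.map (P.δ (n := 0) 0).hom (δ_surjective 0)
    (NormalSubloop.sInf {(NormalSub.ker f).obj (op ⦋1⦌), NormalSubloop.ker (P.δ (n := 0) 1).hom})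

theorem mem_kernelComponentVertices {x : P _⦋0⦌} : x ∈ kernelComponentVertices f ↔
    ∃ e : P _⦋1⦌, f.app _ e = 1 ∧ P.δ 1 e = 1 ∧ P.δ 0 e = x := by
  constructor
  · rintro ⟨e, he, rfl⟩
    exact ⟨e, NormalSubloop.mem_ker.1 (he _ (Or.inl rfl)),
      NormalSubloop.mem_ker.1 (he _ (Or.inr rfl)), rfl⟩
  · rintro ⟨e, h1, h2, rfl⟩
    refine ⟨e, ?_, rfl⟩
    rintro _ (rfl | rfl)
    exacts [NormalSubloop.mem_ker.2 h1, NormalSubloop.mem_ker.2 h2]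

/-- The connected part of the kernel of `f`, as a normal subobject of the domain. -/
def kernelConnectedPart : NormalSub P where
  obj n := NormalSubloop.sInf (insert ((NormalSub.ker f).obj n)
    {N | ∃ v : n ⟶ op ⦋0⦌, N = (kernelComponentVertices f).comap (P.map v).hom})
  map_mem {m n} θ x hx := by
    rintro _ (rfl | ⟨v, rfl⟩)
    · exact (NormalSub.ker f).map_mem θ (hx _ (Or.inl rfl))
    · have h := hx _ (Or.inr ⟨θ ≫ v, rfl⟩)
      change P.map v (P.map θ x) ∈ kernelComponentVertices f
      rw [map_map]
      exact h

theorem mem_kernelConnectedPart {n : SimplexCategoryᵒᵖ} {x : P.obj n} :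
    x ∈ (kernelConnectedPart f).obj n ↔
      ∃ hx : x ∈ (NormalSub.ker f).obj n,
        (⟨x, hx⟩ : {x // x ∈ (NormalSub.ker f).obj n}) ∈ (connectedPart (kernelObj f)).obj n := by
  have key (v : n ⟶ op ⦋0⦌) (hx : x ∈ (NormalSub.ker f).obj n) :
      P.map v x ∈ kernelComponentVertices f ↔ (kernelObj f).map v
        (⟨x, hx⟩ : {x // x ∈ (NormalSub.ker f).obj n}) ∈ componentVertices (kernelObj f) := by
    rw [mem_componentVertices, mem_kernelComponentVertices]
    constructor
    · rintro ⟨e, h, h1, h0⟩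
      exact ⟨⟨e, NormalSubloop.mem_ker.2 h⟩, Subtype.ext h1, Subtype.ext h0⟩
    · rintro ⟨e, h1, h0⟩
      exact ⟨e.1, NormalSubloop.mem_ker.1 e.2, congrArg Subtype.val h1, congrArg Subtype.val h0⟩
  constructor
  · intro h
    have hx := h _ (Or.inl rfl)
    exact ⟨hx, mem_connectedPart.2 fun v => (key v hx).1 (h _ (Or.inr ⟨v, rfl⟩))⟩
  · rintro ⟨hx, h⟩ _ (rfl | ⟨v, rfl⟩)
    · exact hx
    · exact (key v hx).2 (mem_connectedPart.1 h v)

/-- `[K,P,P] ∨ K₀` as a normal subobject of `P`, where `K` is the kernel of `f`. -/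
def centralKer : NormalSub P where
  obj n := ((NormalSub.ker f).associator.obj n).prod ((kernelConnectedPart f).obj n)
  map_mem θ x hx := by
    obtain ⟨a, ha, k, hk, rfl⟩ := NormalSubloop.mem_prod.1 hx
    rw [map_mul]
    exact NormalSubloop.mem_prod.2 ⟨_, NormalSub.map_mem _ θ ha, _, NormalSub.map_mem _ θ hk, rfl⟩

theorem mem_centralKer_of_mem_associator {n : SimplexCategoryᵒᵖ} {x : P.obj n}
    (hx : x ∈ (NormalSub.ker f).associator.obj n) : x ∈ (centralKer f).obj n :=
  NormalSubloop.mem_prod.2 ⟨x, hx, 1, NormalSubloop.one_mem _, (mul_one x).symm⟩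

theorem mem_centralKer_of_mem_kernelConnectedPart {n : SimplexCategoryᵒᵖ} {x : P.obj n}
    (hx : x ∈ (kernelConnectedPart f).obj n) : x ∈ (centralKer f).obj n :=
  NormalSubloop.mem_prod.2 ⟨1, NormalSubloop.one_mem _, x, hx, (one_mul x).symm⟩

theorem mem_ker_of_mem_associator {n : SimplexCategoryᵒᵖ} {x : P.obj n}
    (hx : x ∈ (NormalSub.ker f).associator.obj n) : x ∈ (NormalSub.ker f).obj n := by
  refine NormalSubloop.normalClosure_le ?_ hx
  rintro a ⟨k, y, z, hk, h⟩
  refine NormalSubloop.mem_ker.2 ?_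
  have hk : f.app n k = 1 := NormalSubloop.mem_ker.1 hk
  rcases h with rfl | rfl | rfl <;> rw [NormalSubloop.map_assocElt] <;>
    simp [NormalSubloop.assocElt, hk]

/-- A supremum in `K` is compared with a product in `P`. They agree because every element of the
product is some `a * k` with factors in the two terms, hence lies in any normal subobject of `K`
containing both. -/
theorem mem_hopfDenominator {n : SimplexCategoryᵒᵖ} (x : (kernelObj f).obj n) :
    x ∈ (hopfDenominator f).obj n ↔ x.1 ∈ (centralKer f).obj n := by
  constructor
  · have h : hopfDenominator f ≤ (centralKer f).comap (NormalSub.ker f).ι := by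
      refine NormalSub.sup_le ?_ ?_
      · intro m y hy
        exact mem_centralKer_of_mem_associator f hy
      · intro m y hy
        exact mem_centralKer_of_mem_kernelConnectedPart f
          ((mem_kernelConnectedPart f).2 ⟨y.2, hy⟩)
    exact h n x
  · intro hx
    obtain ⟨a, ha, k, hk, e⟩ := NormalSubloop.mem_prod.1 hx
    obtain ⟨hk1, hk2⟩ := (mem_kernelConnectedPart f).1 hk
    have : x = (⟨a, mem_ker_of_mem_associator f ha⟩ * ⟨k, hk1⟩ :
        {x // x ∈ (NormalSub.ker f).obj n}) := Subtype.ext e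
    rw [this]
    exact NormalSubloop.mul_mem _ (NormalSub.le_sup_left _ _ _ _ ha)
      (NormalSub.le_sup_right _ _ _ _ hk2)

theorem mem_hopfNumerator {n : SimplexCategoryᵒᵖ} (x : (kernelObj f).obj n) :
    x ∈ (hopfNumerator f).obj n ↔ unitHom P n x.1 = 1 :=
  mem_associator_sup_connectedPart

theorem hopfDenominator_le_hopfNumerator : hopfDenominator f ≤ hopfNumerator f := by
  refine NormalSub.sup_le ?_ ?_
  · intro n x hx
    refine NormalSub.le_sup_left _ _ _ _ ?_
    refine NormalSubloop.map_mem_associator (MonoidHom.id _) (fun y _ => NormalSubloop.mem_top y) hx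
  · intro n x hx
    refine NormalSub.le_sup_right _ _ _ _ (mem_connectedPart.2 fun v => ?_)
    obtain ⟨e, h1, h0⟩ := mem_componentVertices.1 (mem_connectedPart.1 hx v)
    exact mem_componentVertices.2 ⟨e.1, congrArg Subtype.val h1, congrArg Subtype.val h0⟩

/-! ### Universal property of the centralization -/

variable {f}

theorem mem_ker_of_mem_centralKer {n : SimplexCategoryᵒᵖ} {x : P.obj n}
    (hx : x ∈ (centralKer f).obj n) : f.app n x = 1 := by
  obtain ⟨a, ha, k, hk, rfl⟩ := NormalSubloop.mem_prod.1 hx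
  rw [map_mul, NormalSubloop.mem_ker.1 (mem_ker_of_mem_associator f ha),
    NormalSubloop.mem_ker.1 ((mem_kernelConnectedPart f).1 hk).1, one_mul]

theorem unitHom_eq_one_of_mem_centralKer {n : SimplexCategoryᵒᵖ} {x : P.obj n}
    (hx : x ∈ (centralKer f).obj n) : unitHom P n x = 1 :=
  (mem_hopfNumerator f ⟨x, NormalSubloop.mem_ker.2 (mem_ker_of_mem_centralKer hx)⟩).1
    (hopfDenominator_le_hopfNumerator f _ _ ((mem_hopfDenominator f _).2 hx))

/-- A morphism over `B` to a central extension is trivial on `[K,P,P] ∨ K₀`. -/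
theorem IsCentral.app_eq_one_of_mem_centralKer {E : SimplicialObject LoopCat.{u}} {p : E ⟶ B}
    (hp : IsCentral p) {g : P ⟶ E} (hg : g ≫ p = f) {n : SimplexCategoryᵒᵖ} {x : P.obj n}
    (hx : x ∈ (centralKer f).obj n) : g.app n x = 1 := by
  have hker {m} {k : P.obj m} (hk : f.app m k = 1) : p.app m (g.app m k) = 1 := by
    rw [app_eq_of_comp_eq hg, hk]
  obtain ⟨a, ha, k, hk, rfl⟩ := NormalSubloop.mem_prod.1 hx
  have h1 : g.app n a = 1 := by
    refine NormalSubloop.mem_ker.1 (NormalSubloop.normalClosure_le (N := (NormalSub.ker g).obj n)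
      ?_ ha)
    rintro a ⟨k, y, z, hk, h⟩
    refine NormalSubloop.mem_ker.2 (hp.assoc n _ ⟨g.app n k, g.app n y, g.app n z,
      NormalSubloop.mem_ker.2 (hker (NormalSubloop.mem_ker.1 hk)), ?_⟩)
    rcases h with rfl | rfl | rfl <;> simp only [NormalSubloop.map_assocElt, true_or, or_true]
  have h2 : g.app n k = 1 := by
    refine hp.discrete n _ (hker (NormalSubloop.mem_ker.1 (hk _ (Or.inl rfl)))) ?_
    obtain ⟨e, he, h1, h0⟩ := (mem_kernelComponentVertices f).1
      (hk _ (Or.inr ⟨initialVertex n, rfl⟩))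
    -- The edge `e` runs in `K` from `1` to the initial vertex of `k`. Its image starts at `1` in a
    -- discrete kernel, so it is trivial, and so is the initial vertex of `g k`.
    have h3 : g.app _ e = 1 := by
      refine hp.discrete _ _ (hker he) ?_
      have h4 : P.map (initialVertex (op ⦋1⦌)) e = 1 := by
        rw [← h1]
        refine congrArg (fun θ => P.map θ e) ?_
        apply Quiver.Hom.unop_inj
        ext k; fin_cases k; rfl
      rw [← app_map, h4, map_one]
    change P.δ 0 e = P.map (initialVertex n) k at h0
    rw [← app_map, ← h0]
    refine (app_map g _ e).trans ?_
    rw [h3, map_one]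
  rw [map_mul, h1, h2, one_mul]

/-- The centralization `P/([K,P,P] ∨ K₀) → B` of an extension is central. -/
theorem isCentral_of_quotientMap_comp {p : (centralKer f).quotient ⟶ B}
    (hp : (centralKer f).quotientMap ≫ p = f) : IsCentral p := by
  refine ⟨?_, ?_⟩
  · rintro n _ ⟨k, x, y, hk, h⟩
    obtain ⟨k, rfl⟩ := (centralKer f).quotientMap_surjective n k
    obtain ⟨x, rfl⟩ := (centralKer f).quotientMap_surjective n x
    obtain ⟨y, rfl⟩ := (centralKer f).quotientMap_surjective n y
    have hk : f.app n k = 1 := (app_eq_of_comp_eq hp n k).symm.trans (NormalSubloop.mem_ker.1 hk)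
    have key {a : P.obj n} (ha : a ∈ NormalSubloop.assocSet ((NormalSub.ker f).obj n)) :
        (centralKer f).quotientMap.app n a = 1 :=
      (centralKer f).quotientMap_eq_one_iff.2
        (mem_centralKer_of_mem_associator f (NormalSubloop.subset_normalClosure _ ha))
    rcases h with rfl | rfl | rfl <;> rw [← NormalSubloop.map_assocElt] <;> apply key
    · exact ⟨k, x, y, NormalSubloop.mem_ker.2 hk, Or.inl rfl⟩
    · exact ⟨k, x, y, NormalSubloop.mem_ker.2 hk, Or.inr (Or.inl rfl)⟩
    · exact ⟨k, x, y, NormalSubloop.mem_ker.2 hk, Or.inr (Or.inr rfl)⟩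
  · intro n k hk hv
    obtain ⟨k, rfl⟩ := (centralKer f).quotientMap_surjective n k
    rw [app_eq_of_comp_eq hp] at hk
    rw [← app_map, quotientMap_eq_one_iff] at hv
    rw [quotientMap_eq_one_iff]
    -- The quotient of `k` by the degenerate simplex on its initial vertex lies in `K` and starts at
    -- `1`, hence lies in `K₀`; by `hv` the degenerate simplex is in `centralKer f`.
    have h1 : rdiv k (P.map (degenerate n) (P.map (initialVertex n) k)) ∈ (centralKer f).obj n := by
      refine mem_centralKer_of_mem_kernelConnectedPart f ((mem_kernelConnectedPart f).2 ⟨?_, ?_⟩)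
      · refine NormalSubloop.mem_ker.2 ?_
        change f.app n _ = 1
        rw [AlgLoop.map_rdiv, app_map, app_map, hk]
        simp
      · refine mem_connectedPart_of_initialVertex (A := kernelObj f) ?_
        refine mem_componentVertices.2 ⟨1, map_one _, (map_one _).trans (Subtype.ext (Eq.symm ?_))⟩
        change P.map (initialVertex n) _ = 1
        rw [AlgLoop.map_rdiv, map_degenerate, rdiv_self]
    have := ((centralKer f).obj n).mul_mem h1 ((centralKer f).map_mem (degenerate n) hv)
    rwa [rdiv_mul] at this

/-- By universality of the unit, a morphism to a discrete group factors through it. -/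
theorem app_eq_one_of_unitHom_eq_one {A : SimplicialObject LoopCat.{u}} {G : GrpCat.{u}}
    (g : A ⟶ grpInclusion.obj G) {n : SimplexCategoryᵒᵖ} {x : A.obj n} (hx : unitHom A n x = 1) :
    g.app n x = 1 := by
  obtain ⟨h, rfl⟩ := (reflectionAdj.homEquiv A G).surjective g
  rw [Adjunction.homEquiv_unit]
  change h.hom (unitHom A n x) = 1
  rw [hx, map_one]

/-- The kernel of the unit of the centralization is the image of the kernel of the unit. -/
theorem unitHom_quotientMap_eq_one {n : SimplexCategoryᵒᵖ} {x : P.obj n}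
    (hx : unitHom (centralKer f).quotient n ((centralKer f).quotientMap.app n x) = 1) :
    unitHom P n x = 1 := by
  -- The unit of `P` kills `centralKer f`, so it descends to the centralization, where it is a
  -- morphism to a discrete group.
  obtain ⟨d, hd⟩ := exists_desc_of_ker (centralKer f).quotientMap_surjective
    (reflectionAdj.unit.app P) fun n x hx =>
      unitHom_eq_one_of_mem_centralKer ((centralKer f).quotientMap_eq_one_iff.1 hx)
  have := app_eq_one_of_unitHom_eq_one d hx
  rw [app_eq_of_comp_eq hd] at this
  exact this

end

end SimplicialLoop

namespace SimplicialLoop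

open NormalSub

/-! ### The Hopf formula -/

variable {P B E : SimplicialObject LoopCat.{u}} {f : P ⟶ B} {p : E ⟶ B}

/-- The trivial morphism. -/
def trivialHom (A E : SimplicialObject LoopCat.{u}) : A ⟶ E where
  app n := ConcreteCategory.ofHom (C := LoopCat) (1 : A.obj n →* E.obj n)
  naturality m n θ := by
    refine ConcreteCategory.hom_ext _ _ fun x => ?_
    exact (map_one (E.map θ).hom).symm

theorem ι_app_eq_one {n : SimplexCategoryᵒᵖ} (x : (kernelObj f).obj n) :
    f.app n ((NormalSub.ker f).ι.app n x) = 1 :=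
  NormalSubloop.mem_ker.1 x.2

/-- The morphism `k ↦ (1, g k)` from the kernel of `f` to the kernel pair of `p`, where `g` is a
morphism over `B`. -/
noncomputable def kernelToKernelPair (g : P ⟶ E) (hg : g ≫ p = f) :
    kernelObj f ⟶ pullback p p :=
  pullback.lift (trivialHom _ _) ((NormalSub.ker f).ι ≫ g) (hom_ext fun n x => by
    rw [Category.assoc, hg, comp_app_apply, comp_app_apply, ι_app_eq_one]
    exact map_one (p.app n).hom)

theorem fst_kernelToKernelPair (g : P ⟶ E) (hg : g ≫ p = f) {n : SimplexCategoryᵒᵖ}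
    (x : (kernelObj f).obj n) :
    (pullback.fst p p).app n ((kernelToKernelPair g hg).app n x) = 1 :=
  app_eq_of_comp_eq (pullback.lift_fst _ _ _) n x

theorem snd_kernelToKernelPair (g : P ⟶ E) (hg : g ≫ p = f) {n : SimplexCategoryᵒᵖ}
    (x : (kernelObj f).obj n) :
    (pullback.snd p p).app n ((kernelToKernelPair g hg).app n x) = g.app n x.1 :=
  app_eq_of_comp_eq (pullback.lift_snd _ _ _) n x

/-- The morphism from `K ∧ ([P,P,P] ∨ P₀)` to the Galois group that sends `k` to the class of
`(1, g k)`. -/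
noncomputable def toGaloisGroup (g : P ⟶ E) (hg : g ≫ p = f) :
    (hopfNumerator f).toSimplicial ⟶ grpInclusion.obj (galoisGroup simplicialLoopReflector p) where
  app n := ConcreteCategory.ofHom (C := LoopCat)
    (X := LoopCat.of {x // x ∈ (hopfNumerator f).obj n})
    (Y := (grpInclusion.obj (galoisGroup simplicialLoopReflector p)).obj n)
    (MonoidHom.codRestrict ((unitHom (pullback p p) n).comp
      ((kernelToKernelPair g hg).app n).hom |>.comp ((hopfNumerator f).obj n).subtype)
      (MonoidHom.ker ((simplicialLoopReflector.map (pullback.fst p p)).hom.prod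
        (simplicialLoopReflector.map (pullback.snd p p)).hom)) (fun x => by
        refine Prod.ext ?_ ?_
        · refine (unitHom_app (pullback.fst p p) _).symm.trans ?_
          exact (congrArg _ (fst_kernelToKernelPair g hg x.1)).trans (map_one _)
        · refine (unitHom_app (pullback.snd p p) _).symm.trans ?_
          refine (congrArg _ (snd_kernelToKernelPair g hg x.1)).trans ?_
          exact unitHom_app_eq_one g ((mem_hopfNumerator f x.1).1 x.2)))
  naturality m n θ := by
    refine ConcreteCategory.hom_ext _ _ fun x => Subtype.ext ?_
    refine (congrArg (unitHom (pullback p p) n) (app_map (kernelToKernelPair g hg) θ x.1)).trans ?_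
    exact unitHom_map θ _

theorem toGaloisGroup_eq_one_iff (g : P ⟶ E) (hg : g ≫ p = f) {n : SimplexCategoryᵒᵖ}
    (x : (hopfNumerator f).toSimplicial.obj n) : (toGaloisGroup g hg).app n x = 1 ↔
      unitHom (pullback p p) n ((kernelToKernelPair g hg).app n x.1) = 1 :=
  Subtype.ext_iff

end SimplicialLoop

/-! ### The main theorem -/

open SimplicialLoop NormalSub

theorem mainTheorem10 {B P : SimplicialObject LoopCat.{u}} (f : P ⟶ B)
    (hf : IsRegularEpi f) (hP : IsRegularProjective P) :
    (∃ (E : SimplicialObject LoopCat.{u}) (p : E ⟶ B),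
      IsWeaklyUniversalNormalExtension reflectionAdj p) ∧
    hopfDenominator f ≤ hopfNumerator f ∧
    ∀ (E : SimplicialObject LoopCat.{u}) (p : E ⟶ B),
      IsWeaklyUniversalNormalExtension reflectionAdj p →
        Nonempty (grpInclusion.obj (galoisGroup simplicialLoopReflector p) ≅ hopfQuotient f) := by
  have hfs := surjective_of_isRegularEpi hf
  set q := (centralKer f).quotientMap
  obtain ⟨c, hc⟩ := exists_desc_of_ker (centralKer f).quotientMap_surjective f
    fun n x hx => mem_ker_of_mem_centralKer ((centralKer f).quotientMap_eq_one_iff.1 hx)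
  have hcn : IsNormalExtension reflectionAdj c := by
    refine (isCentral_of_quotientMap_comp hc).isNormalExtension fun n b => ?_
    obtain ⟨x, rfl⟩ := hfs n b
    exact ⟨_, app_eq_of_comp_eq hc n x⟩
  -- every lift of `f` to a normal extension factors through the centralization
  have hlift {E : SimplicialObject LoopCat.{u}} (p : E ⟶ B)
      (hp : IsNormalExtension reflectionAdj p) :
      ∃ (g : P ⟶ E) (d : (centralKer f).quotient ⟶ E), g ≫ p = f ∧ q ≫ d = g ∧ d ≫ p = c := by
    obtain ⟨g, hg⟩ := hP p f hp.isRegularEpi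
    obtain ⟨d, hd⟩ := exists_desc_of_ker (centralKer f).quotientMap_surjective g fun n x hx =>
      (isCentral_of_isNormalExtension hp).app_eq_one_of_mem_centralKer hg
        ((centralKer f).quotientMap_eq_one_iff.1 hx)
    have := epi_of_surjective (centralKer f).quotientMap_surjective
    refine ⟨g, d, hg, hd, ?_⟩
    rw [← cancel_epi (centralKer f).quotientMap, ← Category.assoc, hd, hg, hc]
  refine ⟨⟨_, c, hcn, fun E' p' hp' => ?_⟩, hopfDenominator_le_hopfNumerator f, ?_⟩
  · obtain ⟨-, d, -, -, hd⟩ := hlift p' hp'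
    exact ⟨d, hd⟩
  intro E p hp
  obtain ⟨g, d, hg, hqd, hdp⟩ := hlift p hp.isNormal
  -- The only use of weak universality: a morphism from `E` back to the centralization.
  obtain ⟨w, hw⟩ := hp.exists_hom c hcn
  have hcn' := (isNormalExtension_iff.1 hcn).2
  have hpn := (isNormalExtension_iff.1 hp.isNormal).2
  refine nonempty_iso_quotient _ (toGaloisGroup g hg) ?_ ?_
  · rintro n ⟨a, ha⟩
    obtain ⟨z, rfl⟩ := unitHom_surjective (A := pullback p p) n a
    have h1 : unitHom E n ((pullback.fst p p).app n z) = 1 :=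
      (unitHom_app _ z).trans (congrArg Prod.fst ha)
    have h2 : unitHom E n ((pullback.snd p p).app n z) = 1 :=
      (unitHom_app _ z).trans (congrArg Prod.snd ha)
    -- the element `y / x` of the kernel of `p`, where `z = (x, y)`
    set k := rdiv ((pullback.snd p p).app n z) ((pullback.fst p p).app n z) with hk
    have hk1 : unitHom E n k = 1 := by rw [unitHom_rdiv, h1, h2]; simp
    have hk2 : p.app n k = 1 := by
      rw [hk, AlgLoop.map_rdiv, fst_app_eq_snd_app, rdiv_self]
    obtain ⟨x, hx⟩ := (centralKer f).quotientMap_surjective n (w.app n k)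
    have hx1 : unitHom P n x = 1 :=
      unitHom_quotientMap_eq_one (by rw [hx]; exact unitHom_app_eq_one w hk1)
    have hx2 : f.app n x = 1 := by
      rw [← app_eq_of_comp_eq hc n x, hx, app_eq_of_comp_eq hw, hk2]
    -- The endomorphism `w ≫ d` of `E` lies over `B`, so it fixes every element killed by the unit.
    have hx3 : g.app n x = k := by
      have : (w ≫ d).app n k = (𝟙 E : E ⟶ E).app n k :=
        app_eq_of_unitHom_eq_one hpn (w ≫ d) (𝟙 E)
          (by rw [Category.assoc, hdp, hw, Category.id_comp]) hk1
      rw [← app_eq_of_comp_eq hqd n x]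
      exact (congrArg _ hx).trans this
    refine ⟨⟨⟨x, NormalSubloop.mem_ker.2 hx2⟩, (mem_hopfNumerator f _).2 hx1⟩, Subtype.ext ?_⟩
    change unitHom (pullback p p) n ((kernelToKernelPair g hg).app n _) = unitHom (pullback p p) n z
    -- With `a` the first entry of `z`, one has `z = (1, k) (a, a)`, and the unit kills `(a, a)`.
    have hdiag := unitHom_app_eq_one (pullback.lift (𝟙 E) (𝟙 E) (rfl : 𝟙 E ≫ p = 𝟙 E ≫ p)) h1
    have e : (kernelToKernelPair g hg).app n
        (⟨x, NormalSubloop.mem_ker.2 hx2⟩ : {x // x ∈ (NormalSub.ker f).obj n}) *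
          (pullback.lift (𝟙 E) (𝟙 E) (rfl : 𝟙 E ≫ p = 𝟙 E ≫ p)).app n
            ((pullback.fst p p).app n z) = z := by
      refine pullback_ext ?_ ?_
      · rw [map_mul, app_eq_of_comp_eq (pullback.lift_fst _ _ _)]
        exact (congrArg (· * _) (fst_kernelToKernelPair g hg _)).trans (one_mul _)
      · rw [map_mul, app_eq_of_comp_eq (pullback.lift_snd _ _ _)]
        refine (congrArg (· * _) ((snd_kernelToKernelPair g hg _).trans hx3)).trans ?_
        exact rdiv_mul _ _
    rw [← congrArg (unitHom (pullback p p) n) e, map_mul, hdiag, mul_one]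
    rfl
  · intro n x
    rw [toGaloisGroup_eq_one_iff]
    have hx := (mem_hopfNumerator f x.1).1 x.2
    refine Iff.trans ?_ (mem_hopfDenominator f x.1).symm
    constructor
    · intro h
      have h1 := hpn n _ (fst_kernelToKernelPair g hg x.1) h
      rw [snd_kernelToKernelPair] at h1
      -- Both `q` and `g ≫ w` lie over `B`, so they agree on elements killed by the unit; hence `g x
      -- = 1` forces `q x = 1`.
      rw [← quotientMap_eq_one_iff, app_eq_of_unitHom_eq_one hcn' q (g ≫ w)
        (by rw [Category.assoc, hw, hg, hc]) hx, comp_app_apply, h1, map_one]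
    · intro h
      have h1 : g.app n x.1.1 = 1 :=
        (isCentral_of_isNormalExtension hp.isNormal).app_eq_one_of_mem_centralKer hg h
      have : (kernelToKernelPair g hg).app n x.1 = 1 := by
        refine pullback_ext ?_ ?_
        · rw [fst_kernelToKernelPair, map_one]
        · rw [snd_kernelToKernelPair, h1, map_one]
      rw [this, map_one]
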